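/- **Conventions.** Scalars are real or complex; transfer functions are matrices of rational functions of $z$, $z$ being the forward shift, $z\,x(t)=x(t+1)$. A rational matrix is *causal* if it is analytic at $\infty$, and *stable* if it is analytic in $\{|z|\ge 1\}\cup\{\infty\}$; for such $W(z)=\sum_{k\ge 0}W_kz^{-k}$, put $W(z)u(t)=\sum_{k\ge 0}W_ku(t-k)$. A point $\alpha$ is a *zero* of $W$ if $W$ is analytic at $\alpha$ and $W(\alpha)v=0$ for some $v\neq 0$. $W$ is *minimum-phase* if it is stable and all its zeros are in the closed unit disc (in particular $\infty$ is not a zero, and $W$ has full column rank). $\mathbf H_t(u)$ is the closed linear span, in the $L^2$ space of random variables, of the components of $u(s)$, $s\le t$; $\mathbb E\{\cdot\mid\mathbf H_{t-1}(u)\}$ is the orthogonal projection onto the strict past of $u$. A normalized white noise $e$ is called the *innovation* of $y$ if $\mathbf H_t(e)=\mathbf H_t(y)$ for all $t$. **Theorem A.2.** Let $y=\begin{bmatrix}y_1\\y_2\end{bmatrix}=\begin{bmatrix}W_1(z)\\W_2(z)\end{bmatrix}e$, where $e$ is an $m$-dimensional zero-mean normalized white noise, $W_1$ is $m\times m$ with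 $\det W_1\not\equiv 0$, $W_2$ is $p\times m$ and $W=\begin{bmatrix}W_1\\W_2\end{bmatrix}$ is minimum-phase. Assume that $W_2$ is minimum-phase. Then $e$ is the innovation of the joint process $y$, $e(t)$ is uncorrelated with the strict past $\mathbf H_{t-1}(y_2)$, and the following holds. 1. There is a feedback representation $$y_1(t)=F(z)y_2(t)+K_+e(t),\qquad y_2(t)=H(z)y_1(t),$$ where $W_2=HW_1$, $K_+$ is a constant matrix, $F(z)=z^{-1}\bar F(z)$ with $\bar F$ rational and causal, and $W_1=FW_2+K_+$. (As $H$ may be unstable or not causal, $y_2=H(z)y_1$ means: $d(z)y_2=N(z)y_1$ whenever $d$ is a polynomial and $N=dH$ a polynomial matrix.) The only possible poles of $\bar F$ in $\{|z|\ge1\}$ are zeros of $W_2$ on the unit circle. So if $W_2$ has no zero on the unit circle, then $\bar F$ is stable, and $F$ is stable and strictly causal. If $W_1$ has no zero at $\infty$, then $K_+$ is minimum-phase (i.e. invertible). 2. $\bar F=F_+$ is the transfer function of the one-step ahead Wiener predictor of $y_1$ based on the strict past of $y_2$, and $K_+e$ is the prediction error: $$\mathbb E\{y_1(t)\mid\mathbf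 H_{t-1}(y_2)\}=\bar F(z)y_2(t-1),\qquad y_1(t)-\mathbb E\{y_1(t)\mid\mathbf H_{t-1}(y_2)\}=K_+e(t).$$ Here $\bar FW_2$ is stable and $\bar F(z)y_2(t-1)=(\bar FW_2)(z)e(t-1)$, which is also the convergent series $\sum_k\bar F_k\,y_2(t-1-k)$ whenever $\bar F$ is stable. 3. The representation is unique: if $y_1(t)=F'(z)y_2(t-1)+v(t)$ for all $t$, where $F'$ is rational, causal and stable and the noise term $v(t)$ is uncorrelated with $\mathbf H_{t-1}(y_2)$ for all $t$, then $F'(z)y_2(t-1)=\mathbb E\{y_1(t)\mid\mathbf H_{t-1}(y_2)\}$, $v(t)=K_+e(t)$ and $F'W_2=\bar FW_2$ (so $F'=\bar F$ if $p=m$); and if $v=K'(z)e$ with $K'$ rational, causal and stable, then $K'=K_+$. -/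

import Mathlib

open scoped Polynomial

noncomputable section

namespace LowRank

/-- The inclusion of the coefficient field (`ℝ` or `ℂ`) into `ℂ`. -/
def toC (𝕜 : Type*) [RCLike 𝕜] : 𝕜 →+* ℂ where
  toFun a := ⟨RCLike.re a, RCLike.im a⟩
  map_one' := by apply Complex.ext <;> simp
  map_mul' a b := by apply Complex.ext <;> simp [RCLike.mul_re, RCLike.mul_im]
  map_zero' := by apply Complex.ext <;> simp
  map_add' a b := by apply Complex.ext <;> simp

section Rational

variable {𝕜 : Type*} [RCLike 𝕜] {ι κ : Type*} [Fintype κ]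

/-! ### Rational functions of `z` (the variable `RatFunc.X`) and rational matrices -/

/-- `α ∈ ℂ` is a pole of `r`. (`RatFunc.num` and `RatFunc.denom` are coprime.) -/
def HasPoleAt (r : RatFunc 𝕜) (α : ℂ) : Prop :=
  r.denom.eval₂ (toC 𝕜) α = 0

/-- The value of `r` at a point `α ∈ ℂ` that is not a pole. -/
def valueAt (r : RatFunc 𝕜) (α : ℂ) : ℂ :=
  r.num.eval₂ (toC 𝕜) α / r.denom.eval₂ (toC 𝕜) α

/-- `r` is proper, i.e. analytic at `z = ∞`, i.e. causal. -/
def IsProper (r : RatFunc 𝕜) : Prop :=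
  r.num.natDegree ≤ r.denom.natDegree

/-- The value at `z = ∞` of a proper `r`. (`RatFunc.denom` is monic.) -/
def valueAtInfinity (r : RatFunc 𝕜) : 𝕜 :=
  r.num.coeff r.denom.natDegree

/-- The `k`-th coefficient `r_k` of the expansion `r(z) = ∑_{k ≥ 0} r_k z^{-k}` at `z = ∞` of a
proper `r`. With `n = deg (denom r)` and `w = z⁻¹`, it is the expansion in `w` of
`(wⁿ num r (1/w)) / (wⁿ denom r (1/w))`, whose denominator has constant coefficient `1`. -/
def impulse (r : RatFunc 𝕜) (k : ℕ) : 𝕜 :=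
  PowerSeries.coeff k
    (((r.num.reflect r.denom.natDegree : 𝕜[X]) : PowerSeries 𝕜) *
      ((r.denom.reflect r.denom.natDegree : 𝕜[X]) : PowerSeries 𝕜)⁻¹)

/-- `W` is causal and stable: every entry is analytic in `{|z| ≥ 1}`, the point `∞` included. -/
def IsStable (W : Matrix ι κ (RatFunc 𝕜)) : Prop :=
  ∀ i j, IsProper (W i j) ∧ ∀ α : ℂ, 1 ≤ ‖α‖ → ¬ HasPoleAt (W i j) α

/-- `α ∈ ℂ` is a (right) zero of `W`: `W` is analytic at `α` and `W(α) v = 0` for some `v ≠ 0`. -/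
def IsZero (W : Matrix ι κ (RatFunc 𝕜)) (α : ℂ) : Prop :=
  (∀ i j, ¬ HasPoleAt (W i j) α) ∧
    ∃ v : κ → ℂ, v ≠ 0 ∧ (W.map fun r => valueAt r α).mulVec v = 0

/-- `∞` is a (right) zero of `W`. -/
def IsZeroAtInfinity (W : Matrix ι κ (RatFunc 𝕜)) : Prop :=
  (∀ i j, IsProper (W i j)) ∧
    ∃ v : κ → ℂ, v ≠ 0 ∧ (W.map fun r => toC 𝕜 (valueAtInfinity r)).mulVec v = 0

/-- `W` is minimum-phase (outer): all its poles are in the open unit disc and all its zeros are in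
the closed unit disc; `∞` counts as a point outside the disc. A `W` that is not of full column
rank has zeros everywhere, so it is not minimum-phase. -/
def IsMinimumPhase (W : Matrix ι κ (RatFunc 𝕜)) : Prop :=
  IsStable W ∧ (∀ α : ℂ, IsZero W α → ‖α‖ ≤ 1) ∧ ¬ IsZeroAtInfinity W

/-- The constant transfer matrix with value `K`. -/
def const (K : Matrix ι κ 𝕜) : Matrix ι κ (RatFunc 𝕜) :=
  K.map RatFunc.C

end Rational

section Shift

/-! ### Vector processes in a Hilbert space of random variables -/

variable {𝕜 : Type*} [RCLike 𝕜] {ℋ : Type*} [NormedAddCommGroup ℋ] [InnerProductSpace 𝕜 ℋ]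
  {ι κ : Type*} [Fintype κ]

/-- `x(t) = W(z) u(t)`, `z` being the forward shift: `x(t) = ∑_{k ≥ 0} W_k u(t - k)`, the series
converging in `ℋ`. For stable `W` and norm-bounded `u` it converges absolutely. -/
def IsOutput (W : Matrix ι κ (RatFunc 𝕜)) (u : ℤ → κ → ℋ) (x : ℤ → ι → ℋ) : Prop :=
  ∀ t i, HasSum (fun k : ℕ => ∑ j, impulse (W i j) k • u (t - k) j) (x t i)

/-- The action `d(z) x(t) = ∑_k d_k x(t + k)` of a polynomial `d` in the forward shift `z`. -/
def shiftAct (d : 𝕜[X]) (x : ℤ → ℋ) (t : ℤ) : ℋ :=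
  d.sum fun k a => a • x (t + k)

/-- `x(t) = G(z) u(t)` as difference equations, for an arbitrary rational `G`: whenever a
polynomial `d` clears the denominators of `G`, i.e. `d G = N` is polynomial, one has
`d(z) x(t) = N(z) u(t)`. -/
def IsDifferenceOutput (G : Matrix ι κ (RatFunc 𝕜)) (u : ℤ → κ → ℋ) (x : ℤ → ι → ℋ) : Prop :=
  ∀ (d : 𝕜[X]) (N : Matrix ι κ 𝕜[X]),
    (∀ i j, algebraMap 𝕜[X] (RatFunc 𝕜) d * G i j = algebraMap 𝕜[X] (RatFunc 𝕜) (N i j)) →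
    ∀ t i, shiftAct d (fun s => x s i) t = ∑ j, shiftAct (N i j) (fun s => u s j) t

/-- The past `H_t(u)` of `u` up to time `t`: the closed linear span of the components of `u(s)`,
`s ≤ t`. The strict past is the one up to `t - 1`. -/
def past (𝕜 : Type*) [RCLike 𝕜] {ℋ : Type*} [NormedAddCommGroup ℋ] [InnerProductSpace 𝕜 ℋ]
    {κ : Type*} (u : ℤ → κ → ℋ) (t : ℤ) : Submodule 𝕜 ℋ :=
  (Submodule.span 𝕜 {x | ∃ s ≤ t, ∃ j, x = u s j}).topologicalClosure

instance past_completeSpace [CompleteSpace ℋ] {κ : Type*} (u : ℤ → κ → ℋ) (t : ℤ) :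
    CompleteSpace (past 𝕜 u t) :=
  inferInstanceAs (CompleteSpace (Submodule.topologicalClosure _))

/-- The one-step ahead Wiener predictor `E{x(t) | H_{t-1}(u)}` of `x` based on the strict past of
`u`: the componentwise orthogonal projection of `x(t)` onto the strict past. -/
def wienerPredictor (𝕜 : Type*) [RCLike 𝕜] {ℋ : Type*} [NormedAddCommGroup ℋ]
    [InnerProductSpace 𝕜 ℋ] [CompleteSpace ℋ] {ι κ : Type*}
    (u : ℤ → κ → ℋ) (x : ℤ → ι → ℋ) : ℤ → ι → ℋ :=
  fun t i => (past 𝕜 u (t - 1)).starProjection (x t i)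

/-- `x(t)` is uncorrelated with the strict past of `u`, for every `t`. -/
def UncorrelatedWithStrictPast (𝕜 : Type*) [RCLike 𝕜] {ℋ : Type*} [NormedAddCommGroup ℋ]
    [InnerProductSpace 𝕜 ℋ] {ι κ : Type*} (x : ℤ → ι → ℋ) (u : ℤ → κ → ℋ) : Prop :=
  ∀ t i, x t i ∈ (past 𝕜 u (t - 1))ᗮ

end Shift

section Noise

open MeasureTheory

variable {𝕜 : Type*} [RCLike 𝕜] {Ω : Type*} [MeasurableSpace Ω] {μ : Measure Ω} {ι κ : Type*}

/-- `e` is a normalized white noise: zero mean, unit covariance, uncorrelated in time. -/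
structure IsNormalizedWhiteNoise (e : ℤ → κ → Lp 𝕜 2 μ) : Prop where
  mean_zero : ∀ t j, ∫ ω, e t j ω ∂μ = 0
  orthonormal : Orthonormal 𝕜 fun q : ℤ × κ => e q.1 q.2

/-- `e` is the normalized innovation process of `y`: a normalized white noise whose past is that
of `y`. -/
structure IsInnovation (e : ℤ → κ → Lp 𝕜 2 μ) (y : ℤ → ι → Lp 𝕜 2 μ) : Prop where
  white : IsNormalizedWhiteNoise e
  past_eq : ∀ t, past 𝕜 e t = past 𝕜 y t

end Noise

end LowRank

end

/-! Everything is computed in the delay `w = z⁻¹`. A rational `r` is written as `a(w) / b(w)`, not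
necessarily reduced: it is causal iff some such `b` has `b(0) ≠ 0`, and stable iff some such `b` has
no zero in the closed disc. In the stable case the impulse response is absolutely summable, so
products of transfer functions act as compositions of filters.

The key fact is `IsMinimumPhase.past_eq`: a minimum-phase output has the same past as its white
noise. By `IsMinimumPhase.exists_stable_left_multiple` there are a stable `V` and a polynomial `g`
with `V W = g(w) I`, where `g` has no zero in the open disc. Hence `g(w) e` lies in the past of the
output. Zeros of `g` on the circle prevent inverting `g` stably. Instead, for `x` orthogonal to that
past, the inner products of `x` with `e(s - k)` solve the recurrence with characteristic polynomial
`g` and tend to zero by Bessel; `eq_zero_of_recurrence` then makes them vanish.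

Applied to `W₂`, this identifies the pasts of `e` and `y₂`. Splitting `W₁ = z⁻¹ A + W₁(∞)` with `A =
advance W₁` stable, the first term contributes a vector in the strict past and the second one
orthogonal to it, so they are the predictor and its error. With the rational left inverse `L = g⁻¹
V` of `W₂`, the choice `F = A L` gives `F W₂ = A`. Uniqueness is uniqueness of orthogonal
projections, together with the recovery of a stable transfer function from its output's inner
products with the noise. -/

namespace LowRank

/-! ### Rational functions as fractions in the delay; causality, stability and expansion at
infinity. -/

section Delay

variable {𝕜 : Type*} [RCLike 𝕜]

theorem norm_toC (a : 𝕜) : ‖toC 𝕜 a‖ = ‖a‖ := by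
  rw [← sq_eq_sq₀ (norm_nonneg _) (norm_nonneg _), Complex.sq_norm, ← RCLike.normSq_eq_def',
    RCLike.normSq_apply, Complex.normSq_apply]
  rfl

/-- The substitution of the delay `w = z⁻¹` into a polynomial. -/
noncomputable def delayHom (𝕜 : Type*) [RCLike 𝕜] : 𝕜[X] →+* RatFunc 𝕜 :=
  Polynomial.eval₂RingHom RatFunc.C (RatFunc.X)⁻¹

theorem eval₂_reflect_inv_mul_pow {K L : Type*} [Field K] [Field L] (i : K →+* L) {x : L}
    (hx : x ≠ 0) {N : ℕ} {f : K[X]} (hf : f.natDegree ≤ N) :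
    (f.reflect N).eval₂ i x⁻¹ * x ^ N = f.eval₂ i x := by
  let := invertibleOfNonzero hx
  simpa using Polynomial.eval₂_reflect_mul_pow i x N f hf

theorem eval₂_C_X_ratFunc (f : 𝕜[X]) :
    f.eval₂ RatFunc.C (RatFunc.X : RatFunc 𝕜) = algebraMap 𝕜[X] (RatFunc 𝕜) f := by
  have h : Polynomial.eval₂RingHom RatFunc.C (RatFunc.X : RatFunc 𝕜) =
      algebraMap 𝕜[X] (RatFunc 𝕜) := by
    apply Polynomial.ringHom_ext <;> simp
  exact congrArg (fun g => g f) h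

theorem delayHom_reflect_mul_pow {f : 𝕜[X]} {N : ℕ} (hf : f.natDegree ≤ N) :
    delayHom 𝕜 (f.reflect N) * RatFunc.X ^ N = algebraMap 𝕜[X] (RatFunc 𝕜) f := by
  rw [← eval₂_C_X_ratFunc, ← eval₂_reflect_inv_mul_pow _ RatFunc.X_ne_zero hf]
  rfl

theorem delayHom_mul_pow {f : 𝕜[X]} {N : ℕ} (hf : f.natDegree ≤ N) :
    delayHom 𝕜 f * RatFunc.X ^ N = algebraMap 𝕜[X] (RatFunc 𝕜) (f.reflect N) := by
  rw [← delayHom_reflect_mul_pow (f := f.reflect N) (N := N), Polynomial.reflect_reflect]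
  exact Polynomial.natDegree_reflect_le.trans (by simp [hf])

theorem delayHom_injective : Function.Injective (delayHom 𝕜) := by
  rw [injective_iff_map_eq_zero]
  intro f hf
  have h := delayHom_mul_pow (le_refl f.natDegree)
  rw [hf, zero_mul, eq_comm, map_eq_zero_iff _ (RatFunc.algebraMap_injective 𝕜)] at h
  simpa using h

@[simp] theorem delayHom_X : delayHom 𝕜 Polynomial.X = (RatFunc.X)⁻¹ := by simp [delayHom]

@[simp] theorem delayHom_C (a : 𝕜) : delayHom 𝕜 (Polynomial.C a) = RatFunc.C a := by
  simp [delayHom]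

variable {r s : RatFunc 𝕜} {a b c d : 𝕜[X]}

theorem delay_rep (hr : IsProper r) :
    r * delayHom 𝕜 (r.denom.reflect r.denom.natDegree) =
      delayHom 𝕜 (r.num.reflect r.denom.natDegree) := by
  have h1 := delayHom_reflect_mul_pow (le_refl r.denom.natDegree)
  have h2 := delayHom_reflect_mul_pow hr
  have hX : (RatFunc.X : RatFunc 𝕜) ^ r.denom.natDegree ≠ 0 := pow_ne_zero _ RatFunc.X_ne_zero
  apply mul_right_cancel₀ hX
  rw [mul_assoc, h1, h2]
  conv_lhs => enter [1]; rw [← RatFunc.num_div_denom r]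
  rw [div_mul_cancel₀]
  simpa using RatFunc.denom_ne_zero r

theorem algebraMap_reflect_rep {N : ℕ} (ha : a.natDegree ≤ N) (hb : b.natDegree ≤ N)
    (h : r * delayHom 𝕜 b = delayHom 𝕜 a) :
    r * algebraMap 𝕜[X] (RatFunc 𝕜) (b.reflect N) = algebraMap 𝕜[X] (RatFunc 𝕜) (a.reflect N) := by
  rw [← delayHom_mul_pow ha, ← delayHom_mul_pow hb, ← mul_assoc, h]

theorem num_mul_reflect {N : ℕ} (hb0 : b ≠ 0) (ha : a.natDegree ≤ N) (hb : b.natDegree ≤ N)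
    (h : r * delayHom 𝕜 b = delayHom 𝕜 a) :
    r.num * b.reflect N = a.reflect N * r.denom := by
  have hb' : b.reflect N ≠ 0 := by simpa using hb0
  rw [RatFunc.num_mul_eq_mul_denom_iff hb', ← algebraMap_reflect_rep ha hb h,
    mul_div_cancel_right₀]
  simpa using hb0

/-- Since `b(0) ≠ 0`, reflection gives `b` the full degree `N`, while the reflected `a` has degree
at most `N`; comparing degrees in `num_mul_reflect` leaves no room for a numerator of larger degree.
-/
theorem isProper_of_rep (hb : b.coeff 0 ≠ 0) (h : r * delayHom 𝕜 b = delayHom 𝕜 a) :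
    IsProper r := by
  set N := max a.natDegree b.natDegree
  have hb0 : b ≠ 0 := by rintro rfl; simp at hb
  have key := num_mul_reflect hb0 (le_max_left _ _) (le_max_right _ _) h
  have h1 : N ≤ (b.reflect N).natDegree :=
    Polynomial.le_natDegree_of_ne_zero (by simpa [Polynomial.coeff_reflect] using hb)
  have h2 : (a.reflect N).natDegree ≤ N :=
    Polynomial.natDegree_reflect_le.trans (by simp [N])
  unfold IsProper
  by_cases hr : r.num = 0
  · simp [hr]
  have h3 := congrArg Polynomial.natDegree key
  rw [Polynomial.natDegree_mul hr (by simpa using hb0)] at h3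
  have h4 := Polynomial.natDegree_mul_le (p := a.reflect N) (q := r.denom)
  lia

theorem coeff_zero_reflect_denom (r : RatFunc 𝕜) :
    (r.denom.reflect r.denom.natDegree).coeff 0 = 1 := by
  simpa [Polynomial.coeff_reflect] using (RatFunc.monic_denom r).coeff_natDegree

theorem isProper_iff_rep : IsProper r ↔
    ∃ a b : 𝕜[X], b.coeff 0 ≠ 0 ∧ r * delayHom 𝕜 b = delayHom 𝕜 a :=
  ⟨fun h => ⟨_, _, by rw [coeff_zero_reflect_denom]; exact one_ne_zero, delay_rep h⟩,
    fun ⟨_, _, hb, h⟩ => isProper_of_rep hb h⟩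

/-- The impulse response as a power series in the delay. -/
noncomputable def impulseSeries (r : RatFunc 𝕜) : PowerSeries 𝕜 :=
  ((r.num.reflect r.denom.natDegree : 𝕜[X]) : PowerSeries 𝕜) *
    ((r.denom.reflect r.denom.natDegree : 𝕜[X]) : PowerSeries 𝕜)⁻¹

theorem coeff_impulseSeries (r : RatFunc 𝕜) (k : ℕ) :
    PowerSeries.coeff k (impulseSeries r) = impulse r k := rfl

/-- Two fractions for the same function cross-multiply to the same polynomial, so the expansion may
be computed from any fraction, reduced or not. This makes additivity and multiplicativity below
purely formal. -/
theorem impulseSeries_mul_of_rep (hb : b.coeff 0 ≠ 0) (h : r * delayHom 𝕜 b = delayHom 𝕜 a) :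
    impulseSeries r * (b : PowerSeries 𝕜) = a := by
  have h1 := delay_rep (isProper_of_rep hb h)
  set D := r.denom.reflect r.denom.natDegree with hD
  set N := r.num.reflect r.denom.natDegree with hN
  have h2 : N * b = a * D := by
    apply delayHom_injective
    rw [map_mul, map_mul, ← h1, ← h]; ring
  have h3 : (N : PowerSeries 𝕜) * b = a * D := by exact_mod_cast congrArg Polynomial.toPowerSeries h2
  have h4 : (D : PowerSeries 𝕜) * (D : PowerSeries 𝕜)⁻¹ = 1 := by
    apply PowerSeries.mul_inv_cancel
    rw [← PowerSeries.coeff_zero_eq_constantCoeff_apply, Polynomial.coeff_coe, hD,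
      coeff_zero_reflect_denom]
    exact one_ne_zero
  change (N : PowerSeries 𝕜) * (D : PowerSeries 𝕜)⁻¹ * b = a
  calc _ = (N : PowerSeries 𝕜) * b * (D : PowerSeries 𝕜)⁻¹ := by ring
    _ = a * ((D : PowerSeries 𝕜) * (D : PowerSeries 𝕜)⁻¹) := by rw [h3]; ring
    _ = a := by rw [h4, mul_one]

theorem impulseSeries_unique (hb : b.coeff 0 ≠ 0) (h : r * delayHom 𝕜 b = delayHom 𝕜 a)
    {f : PowerSeries 𝕜} (hf : f * (b : PowerSeries 𝕜) = a) : impulseSeries r = f := by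
  have hb' : (b : PowerSeries 𝕜) ≠ 0 := by
    rintro h0
    rw [Polynomial.coe_eq_zero_iff] at h0
    simp [h0] at hb
  exact mul_right_cancel₀ hb' ((impulseSeries_mul_of_rep hb h).trans hf.symm)

theorem impulseSeries_injOn (hr : IsProper r) (hs : IsProper s)
    (h : impulseSeries r = impulseSeries s) : r = s := by
  obtain ⟨a, b, hb, hab⟩ := isProper_iff_rep.1 hr
  obtain ⟨c, d, hd, hcd⟩ := isProper_iff_rep.1 hs
  have h1 := impulseSeries_mul_of_rep hb hab
  have h2 := impulseSeries_mul_of_rep hd hcd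
  have h3 : a * d = c * b := by
    apply Polynomial.coe_injective 𝕜
    push_cast
    rw [← h1, ← h2, h]; ring
  have hb' : delayHom 𝕜 b ≠ 0 := by
    rw [Ne, map_eq_zero_iff _ delayHom_injective]; rintro rfl; simp at hb
  have hd' : delayHom 𝕜 d ≠ 0 := by
    rw [Ne, map_eq_zero_iff _ delayHom_injective]; rintro rfl; simp at hd
  have h4 := congrArg (delayHom 𝕜) h3
  rw [map_mul, map_mul, ← hab, ← hcd] at h4
  apply mul_right_cancel₀ (mul_ne_zero hb' hd')
  linear_combination h4

theorem rep_add (hr : r * delayHom 𝕜 b = delayHom 𝕜 a) (hs : s * delayHom 𝕜 d = delayHom 𝕜 c) :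
    (r + s) * delayHom 𝕜 (b * d) = delayHom 𝕜 (a * d + c * b) := by
  simp only [map_mul, map_add, ← hr, ← hs]; ring

theorem rep_mul (hr : r * delayHom 𝕜 b = delayHom 𝕜 a) (hs : s * delayHom 𝕜 d = delayHom 𝕜 c) :
    (r * s) * delayHom 𝕜 (b * d) = delayHom 𝕜 (a * c) := by
  simp only [map_mul, ← hr, ← hs]; ring

theorem impulseSeries_add (hr : IsProper r) (hs : IsProper s) :
    impulseSeries (r + s) = impulseSeries r + impulseSeries s := by
  obtain ⟨a, b, hb, hab⟩ := isProper_iff_rep.1 hr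
  obtain ⟨c, d, hd, hcd⟩ := isProper_iff_rep.1 hs
  apply impulseSeries_unique (by simp [Polynomial.mul_coeff_zero, hb, hd]) (rep_add hab hcd)
  push_cast
  rw [← impulseSeries_mul_of_rep hb hab, ← impulseSeries_mul_of_rep hd hcd]; ring

theorem impulseSeries_mul (hr : IsProper r) (hs : IsProper s) :
    impulseSeries (r * s) = impulseSeries r * impulseSeries s := by
  obtain ⟨a, b, hb, hab⟩ := isProper_iff_rep.1 hr
  obtain ⟨c, d, hd, hcd⟩ := isProper_iff_rep.1 hs
  apply impulseSeries_unique (by simp [Polynomial.mul_coeff_zero, hb, hd]) (rep_mul hab hcd)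
  push_cast
  rw [← impulseSeries_mul_of_rep hb hab, ← impulseSeries_mul_of_rep hd hcd]; ring

theorem impulseSeries_delayHom (a : 𝕜[X]) : impulseSeries (delayHom 𝕜 a) = a :=
  impulseSeries_unique (a := a) (b := 1) (by simp) (by simp) (by simp)

theorem valueAtInfinity_eq_impulse (r : RatFunc 𝕜) : valueAtInfinity r = impulse r 0 := by
  rw [← coeff_impulseSeries, impulseSeries, PowerSeries.coeff_zero_eq_constantCoeff_apply, map_mul,
    PowerSeries.constantCoeff_inv, ← PowerSeries.coeff_zero_eq_constantCoeff_apply,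
    ← PowerSeries.coeff_zero_eq_constantCoeff_apply, Polynomial.coeff_coe, Polynomial.coeff_coe,
    coeff_zero_reflect_denom, valueAtInfinity, Polynomial.coeff_reflect]
  simp

theorem valueAtInfinity_mul_of_rep (hb : b.coeff 0 ≠ 0) (h : r * delayHom 𝕜 b = delayHom 𝕜 a) :
    valueAtInfinity r * b.coeff 0 = a.coeff 0 := by
  have h1 := congrArg (PowerSeries.coeff 0) (impulseSeries_mul_of_rep hb h)
  rw [PowerSeries.coeff_zero_eq_constantCoeff_apply, map_mul,
    ← PowerSeries.coeff_zero_eq_constantCoeff_apply, ← PowerSeries.coeff_zero_eq_constantCoeff_apply,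
    Polynomial.coeff_coe, coeff_impulseSeries] at h1
  simpa [valueAtInfinity_eq_impulse] using h1

variable {α : ℂ}

theorem eval₂_reflect_eq (hα : α ≠ 0) {f : 𝕜[X]} {N : ℕ} (hf : f.natDegree ≤ N) :
    (f.reflect N).eval₂ (toC 𝕜) α = f.eval₂ (toC 𝕜) α⁻¹ * α ^ N := by
  have h := eval₂_reflect_inv_mul_pow (toC 𝕜) (inv_ne_zero hα) hf
  rw [inv_inv] at h
  rw [← h, mul_assoc, ← mul_pow, inv_mul_cancel₀ hα, one_pow, mul_one]

/-- By coprimality the reduced denominator divides the reflection of `b`, whose value at `α` is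
`b(α⁻¹)` times a power of `α`. -/
theorem not_hasPoleAt_of_rep (hα : α ≠ 0) (hb : b.eval₂ (toC 𝕜) α⁻¹ ≠ 0)
    (h : r * delayHom 𝕜 b = delayHom 𝕜 a) : ¬ HasPoleAt r α := by
  set N := max a.natDegree b.natDegree
  have hb0 : b ≠ 0 := by rintro rfl; simp at hb
  have key := num_mul_reflect hb0 (le_max_left _ _) (le_max_right _ _) h
  have hdvd : r.denom ∣ b.reflect N :=
    (RatFunc.isCoprime_num_denom r).symm.dvd_of_dvd_mul_left ⟨a.reflect N, by rw [key, mul_comm]⟩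
  intro h0
  have h1 := Polynomial.eval₂_eq_zero_of_dvd_of_eval₂_eq_zero (toC 𝕜) α hdvd h0
  rw [eval₂_reflect_eq hα (le_max_right _ _)] at h1
  exact mul_ne_zero hb (pow_ne_zero _ hα) h1

theorem valueAt_mul_of_rep (hα : α ≠ 0) (hb : b.eval₂ (toC 𝕜) α⁻¹ ≠ 0)
    (h : r * delayHom 𝕜 b = delayHom 𝕜 a) :
    valueAt r α * b.eval₂ (toC 𝕜) α⁻¹ = a.eval₂ (toC 𝕜) α⁻¹ := by
  have hd : r.denom.eval₂ (toC 𝕜) α ≠ 0 := not_hasPoleAt_of_rep hα hb h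
  set N := max a.natDegree b.natDegree
  have hb0 : b ≠ 0 := by rintro rfl; simp at hb
  have key := congrArg (Polynomial.eval₂ (toC 𝕜) α)
    (num_mul_reflect hb0 (le_max_left _ _) (le_max_right _ _) h)
  rw [Polynomial.eval₂_mul, Polynomial.eval₂_mul, eval₂_reflect_eq hα (le_max_left _ _),
    eval₂_reflect_eq hα (le_max_right _ _)] at key
  have hN : α ^ N ≠ 0 := pow_ne_zero _ hα
  apply mul_right_cancel₀ hN
  rw [valueAt, mul_assoc, div_mul_eq_mul_div, div_eq_iff hd, key]

/-- The polynomials in the delay without zeros in the closed unit disc. -/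
def IsStableDenom (b : 𝕜[X]) : Prop :=
  ∀ β : ℂ, ‖β‖ ≤ 1 → b.eval₂ (toC 𝕜) β ≠ 0

theorem toC_coeff_zero (b : 𝕜[X]) : b.eval₂ (toC 𝕜) 0 = toC 𝕜 (b.coeff 0) := by
  rw [Polynomial.eval₂_at_zero]

theorem coeff_zero_ne_zero_of_eval₂ (h : b.eval₂ (toC 𝕜) 0 ≠ 0) : b.coeff 0 ≠ 0 := by
  rw [toC_coeff_zero] at h
  intro h0; simp [h0] at h

theorem IsStableDenom.coeff_zero_ne_zero (hb : IsStableDenom b) : b.coeff 0 ≠ 0 :=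
  coeff_zero_ne_zero_of_eval₂ (hb 0 (by simp))

theorem IsStableDenom.mul (hb : IsStableDenom b) (hd : IsStableDenom d) : IsStableDenom (b * d) :=
  fun β hβ => by rw [Polynomial.eval₂_mul]; exact mul_ne_zero (hb β hβ) (hd β hβ)

/-- The scalar version of stability. -/
def IsStableFun (r : RatFunc 𝕜) : Prop :=
  IsProper r ∧ ∀ α : ℂ, 1 ≤ ‖α‖ → ¬ HasPoleAt r α

theorem isStableFun_of_rep (hb : IsStableDenom b) (h : r * delayHom 𝕜 b = delayHom 𝕜 a) :
    IsStableFun r := by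
  refine ⟨isProper_of_rep hb.coeff_zero_ne_zero h, fun α hα => ?_⟩
  have h0 : α ≠ 0 := by rintro rfl; simp at hα; linarith
  exact not_hasPoleAt_of_rep h0 (hb _ (by rw [norm_inv]; exact inv_le_one_of_one_le₀ hα)) h

theorem isStableDenom_reflect_denom (hr : IsStableFun r) :
    IsStableDenom (r.denom.reflect r.denom.natDegree) := by
  intro β hβ
  by_cases h0 : β = 0
  · rw [h0, toC_coeff_zero, coeff_zero_reflect_denom]; simp
  · rw [eval₂_reflect_eq h0 le_rfl]
    refine mul_ne_zero (hr.2 _ ?_) (pow_ne_zero _ h0)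
    rw [norm_inv]; exact one_le_inv_iff₀.2 ⟨norm_pos_iff.2 h0, hβ⟩

theorem isStableFun_iff_rep : IsStableFun r ↔
    ∃ a b : 𝕜[X], IsStableDenom b ∧ r * delayHom 𝕜 b = delayHom 𝕜 a :=
  ⟨fun h => ⟨_, _, isStableDenom_reflect_denom h, delay_rep h.1⟩,
    fun ⟨_, _, hb, h⟩ => isStableFun_of_rep hb h⟩

theorem IsStableFun.add (hr : IsStableFun r) (hs : IsStableFun s) : IsStableFun (r + s) := by
  obtain ⟨a, b, hb, hab⟩ := isStableFun_iff_rep.1 hr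
  obtain ⟨c, d, hd, hcd⟩ := isStableFun_iff_rep.1 hs
  exact isStableFun_of_rep (hb.mul hd) (rep_add hab hcd)

theorem IsStableFun.mul (hr : IsStableFun r) (hs : IsStableFun s) : IsStableFun (r * s) := by
  obtain ⟨a, b, hb, hab⟩ := isStableFun_iff_rep.1 hr
  obtain ⟨c, d, hd, hcd⟩ := isStableFun_iff_rep.1 hs
  exact isStableFun_of_rep (hb.mul hd) (rep_mul hab hcd)

theorem isStableFun_delayHom (a : 𝕜[X]) : IsStableFun (delayHom 𝕜 a) :=
  isStableFun_of_rep (b := 1) (a := a) (fun β _ => by simp) (by simp)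

theorem isStableFun_sum {ι : Type*} (s : Finset ι) {r : ι → RatFunc 𝕜}
    (h : ∀ i ∈ s, IsStableFun (r i)) : IsStableFun (∑ i ∈ s, r i) :=
  Finset.sum_induction _ IsStableFun (fun _ _ => IsStableFun.add)
    (by simpa using isStableFun_delayHom (0 : 𝕜[X])) h

theorem impulseSeries_sum {ι : Type*} (s : Finset ι) {r : ι → RatFunc 𝕜}
    (h : ∀ i ∈ s, IsStableFun (r i)) :
    impulseSeries (∑ i ∈ s, r i) = ∑ i ∈ s, impulseSeries (r i) := by
  classical
  induction s using Finset.induction_on with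
  | empty => simpa using impulseSeries_delayHom (0 : 𝕜[X])
  | insert i s hi ih =>
    rw [Finset.sum_insert hi, Finset.sum_insert hi, impulseSeries_add (h i (by simp)).1
      (isStableFun_sum s fun j hj => h j (by simp [hj])).1, ih fun j hj => h j (by simp [hj])]

end Delay

/-! ### Absolute summability of stable impulse responses. -/

section AbsSummable

/-- The power series with absolutely summable coefficients. -/
def AbsSummable {R : Type*} [NormedField R] (f : PowerSeries R) : Prop :=
  Summable fun k => ‖PowerSeries.coeff k f‖

theorem AbsSummable.mul {R : Type*} [NormedField R] {f g : PowerSeries R} (hf : AbsSummable f)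
    (hg : AbsSummable g) : AbsSummable (f * g) := by
  have h := summable_norm_sum_mul_antidiagonal_of_summable_norm hf hg
  simpa only [AbsSummable, PowerSeries.coeff_mul] using h

theorem absSummable_coe {R : Type*} [NormedField R] (a : R[X]) :
    AbsSummable (a : PowerSeries R) := by
  apply summable_of_ne_finset_zero (s := a.support)
  intro k hk
  simpa using hk

theorem absSummable_inv_X_sub_C {β : ℂ} (hβ : 1 < ‖β‖) :
    ∃ f : PowerSeries ℂ, AbsSummable f ∧
      f * ((Polynomial.X - Polynomial.C β : ℂ[X]) : PowerSeries ℂ) = 1 := by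
  have hβ0 : β ≠ 0 := by rintro rfl; simp at hβ; linarith
  -- The geometric expansion of `1 / (w - β)`, convergent on the closed disc because `β` lies
  -- outside it.
  refine ⟨PowerSeries.mk fun k => -(β⁻¹ * β⁻¹ ^ k), ?_, ?_⟩
  · simp only [AbsSummable, PowerSeries.coeff_mk, norm_neg, norm_mul, norm_pow]
    exact (summable_geometric_of_lt_one (norm_nonneg _)
      (by rw [norm_inv]; exact inv_lt_one_of_one_lt₀ hβ)).mul_left _
  · ext k
    push_cast
    rw [mul_sub, map_sub, PowerSeries.coeff_mul_C, PowerSeries.coeff_mk]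
    cases k with
    | zero => simp [hβ0]
    | succ k =>
      rw [PowerSeries.coeff_succ_mul_X, PowerSeries.coeff_mk, pow_succ,
        PowerSeries.coeff_one]
      field_simp
      simp

/-- Over `ℂ` the polynomial splits into factors `w - β` with `‖β‖ > 1`, and absolutely summable
series are closed under products. -/
theorem exists_absSummable_inv {b : ℂ[X]} (hb : ∀ β : ℂ, ‖β‖ ≤ 1 → b.eval β ≠ 0) :
    ∃ f : PowerSeries ℂ, AbsSummable f ∧ f * (b : PowerSeries ℂ) = 1 := by
  have hb0 : b ≠ 0 := by rintro rfl; exact hb 0 (by simp) (by simp)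
  have key : ∀ s : Multiset ℂ, (∀ β ∈ s, 1 < ‖β‖) → ∃ f : PowerSeries ℂ, AbsSummable f ∧
      f * (((s.map fun β => Polynomial.X - Polynomial.C β).prod : ℂ[X]) : PowerSeries ℂ) = 1 := by
    intro s
    induction s using Multiset.induction_on with
    | empty => exact fun _ => ⟨1, by simpa using absSummable_coe (1 : ℂ[X]), by simp⟩
    | cons β s ih =>
      intro h
      obtain ⟨f, hf, hf1⟩ := ih fun x hx => h x (Multiset.mem_cons_of_mem hx)
      obtain ⟨g, hg, hg1⟩ := absSummable_inv_X_sub_C (h β (Multiset.mem_cons_self _ _))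
      refine ⟨f * g, hf.mul hg, ?_⟩
      rw [Multiset.map_cons, Multiset.prod_cons, Polynomial.coe_mul]
      rw [mul_comm f g, mul_mul_mul_comm, hf1, hg1, one_mul]
  obtain ⟨f, hf, hf1⟩ := key b.roots fun β hβ => by
    by_contra h
    exact hb β (not_lt.1 h) (Polynomial.isRoot_of_mem_roots hβ)
  have hlc : b.leadingCoeff ≠ 0 := by simpa using hb0
  refine ⟨((Polynomial.C b.leadingCoeff⁻¹ : ℂ[X]) : PowerSeries ℂ) * f,
    (absSummable_coe _).mul hf, ?_⟩
  have h1 := congrArg (fun q : ℂ[X] => (q : PowerSeries ℂ)) (IsAlgClosed.splits b).eq_prod_roots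
  simp only [Polynomial.coe_mul] at h1
  rw [h1, mul_mul_mul_comm, hf1, ← Polynomial.coe_mul, ← Polynomial.C_mul, inv_mul_cancel₀ hlc]
  simp

variable {𝕜 : Type*} [RCLike 𝕜]

theorem absSummable_impulseSeries {r : RatFunc 𝕜} (hr : IsStableFun r) :
    AbsSummable (impulseSeries r) := by
  obtain ⟨a, b, hb, hab⟩ := isStableFun_iff_rep.1 hr
  obtain ⟨f, hf, hf1⟩ := exists_absSummable_inv (b := b.map (toC 𝕜)) fun β hβ => by
    rw [Polynomial.eval_map]; exact hb β hβ
  have h1 := congrArg (PowerSeries.map (toC 𝕜))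
    (impulseSeries_mul_of_rep hb.coeff_zero_ne_zero hab)
  rw [map_mul, ← Polynomial.polynomial_map_coe, ← Polynomial.polynomial_map_coe] at h1
  have h2 : PowerSeries.map (toC 𝕜) (impulseSeries r) =
      ((a.map (toC 𝕜) : ℂ[X]) : PowerSeries ℂ) * f := by
    rw [← h1, mul_assoc, mul_comm _ f, hf1, mul_one]
  have h3 : AbsSummable (PowerSeries.map (toC 𝕜) (impulseSeries r)) := by
    rw [h2]; exact (absSummable_coe _).mul hf
  simpa only [AbsSummable, PowerSeries.coeff_map, norm_toC] using h3

end AbsSummable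

/-! ### Power series in the delay acting on bounded processes. -/

section Filter

variable {𝕜 : Type*} [RCLike 𝕜] {ℋ : Type*} [NormedAddCommGroup ℋ] [InnerProductSpace 𝕜 ℋ]

/-- The action `∑ k, f_k u(t - k)` of a power series in the delay on a scalar process. -/
noncomputable def filt (f : PowerSeries 𝕜) (u : ℤ → ℋ) (t : ℤ) : ℋ :=
  ∑' k : ℕ, PowerSeries.coeff k f • u (t - k)

/-- Norm-bounded processes. -/
def BoundedProcess (u : ℤ → ℋ) : Prop := ∃ C : ℝ, ∀ t, ‖u t‖ ≤ C

theorem BoundedProcess.sum {ι : Type*} (s : Finset ι) {u : ι → ℤ → ℋ}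
    (hu : ∀ i, BoundedProcess (u i)) : BoundedProcess fun t => ∑ i ∈ s, u i t := by
  choose C hC using hu
  exact ⟨∑ i ∈ s, C i, fun t => norm_sum_le_of_le _ fun i _ => hC i t⟩

theorem summable_norm_filt {f : PowerSeries 𝕜} (hf : AbsSummable f) {u : ℤ → ℋ}
    (hu : BoundedProcess u) (t : ℤ) :
    Summable fun k : ℕ => ‖PowerSeries.coeff k f • u (t - k)‖ := by
  obtain ⟨C, hC⟩ := hu
  refine Summable.of_nonneg_of_le (fun _ => norm_nonneg _) (fun k => ?_) (Summable.mul_right C hf)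
  rw [norm_smul]
  exact mul_le_mul_of_nonneg_left (hC _) (norm_nonneg _)

theorem hasSum_filt [CompleteSpace ℋ] {f : PowerSeries 𝕜} (hf : AbsSummable f) {u : ℤ → ℋ}
    (hu : BoundedProcess u) (t : ℤ) :
    HasSum (fun k : ℕ => PowerSeries.coeff k f • u (t - k)) (filt f u t) :=
  (summable_norm_filt hf hu t).of_norm.hasSum

theorem boundedProcess_filt {f : PowerSeries 𝕜} (hf : AbsSummable f) {u : ℤ → ℋ}
    (hu : BoundedProcess u) : BoundedProcess (filt f u) := by
  obtain ⟨C, hC⟩ := hu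
  refine ⟨(∑' k, ‖PowerSeries.coeff k f‖) * C, fun t => ?_⟩
  refine tsum_of_norm_bounded (Summable.hasSum hf |>.mul_right C) fun k => ?_
  rw [norm_smul]
  exact mul_le_mul_of_nonneg_left (hC _) (norm_nonneg _)

theorem filt_coe (a : 𝕜[X]) (u : ℤ → ℋ) (t : ℤ) :
    filt (a : PowerSeries 𝕜) u t = a.sum fun k c => c • u (t - k) := by
  rw [filt, tsum_eq_sum (s := a.support), Polynomial.sum]
  · simp
  · intro k hk
    rw [Polynomial.coeff_coe, Polynomial.notMem_support_iff.1 hk, zero_smul]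

theorem filt_sum_apply [CompleteSpace ℋ] {ι : Type*} (s : Finset ι) {f : ι → PowerSeries 𝕜}
    (hf : ∀ i, AbsSummable (f i)) {u : ℤ → ℋ} (hu : BoundedProcess u) (t : ℤ) :
    filt (∑ i ∈ s, f i) u t = ∑ i ∈ s, filt (f i) u t := by
  refine HasSum.tsum_eq ?_
  simpa only [map_sum, Finset.sum_smul] using hasSum_sum fun i _ => hasSum_filt (hf i) hu t

theorem filt_sum_process [CompleteSpace ℋ] {ι : Type*} (s : Finset ι) {f : PowerSeries 𝕜}
    (hf : AbsSummable f) {u : ι → ℤ → ℋ} (hu : ∀ i, BoundedProcess (u i)) (t : ℤ) :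
    filt f (fun t => ∑ i ∈ s, u i t) t = ∑ i ∈ s, filt f (u i) t := by
  refine HasSum.tsum_eq ?_
  simpa only [Finset.smul_sum] using hasSum_sum fun i _ => hasSum_filt hf (hu i) t

theorem filt_mul_apply [CompleteSpace ℋ] {f g : PowerSeries 𝕜} (hf : AbsSummable f)
    (hg : AbsSummable g) {u : ℤ → ℋ} (hu : BoundedProcess u) (t : ℤ) :
    filt (f * g) u t = filt f (filt g u) t := by
  -- Fubini for an absolutely convergent double series: summing by rows gives the iterated filter,
  -- summing along antidiagonals gives the filter of the product.
  set F : ℕ × ℕ → ℋ := fun q =>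
    (PowerSeries.coeff q.1 f * PowerSeries.coeff q.2 g) • u (t - (q.1 + q.2 : ℕ)) with hF
  have hsum : Summable F := by
    obtain ⟨C, hC⟩ := hu
    apply Summable.of_norm
    refine Summable.of_nonneg_of_le (fun _ => norm_nonneg _) (fun q => ?_)
      (Summable.mul_right C (Summable.mul_norm hf hg))
    rw [hF, norm_smul]
    exact mul_le_mul_of_nonneg_left (hC _) (norm_nonneg _)
  have h1 : HasSum F (filt f (filt g u) t) := by
    have h2 := hsum.hasSum.prod_fiberwise
      (g := fun i => PowerSeries.coeff i f • filt g u (t - i)) fun i => by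
        have h3 := (hasSum_filt hg hu (t - i)).const_smul (PowerSeries.coeff i f)
        convert h3 using 2 with j
        rw [hF]; simp only [mul_smul]; congr 3; push_cast; ring
    have h4 := hasSum_filt hf (boundedProcess_filt hg hu) t
    rw [h4.unique h2]
    exact hsum.hasSum
  have h5 := (Finset.HasAntidiagonal.sigmaAntidiagonalEquivProd (A := ℕ)).hasSum_iff.2 h1
  refine (h5.sigma (g := fun k : ℕ => PowerSeries.coeff k (f * g) • u (t - k)) fun n => ?_).tsum_eq
  have h6 := hasSum_fintype fun q : Finset.HasAntidiagonal.antidiagonal n =>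
    (F ∘ Finset.HasAntidiagonal.sigmaAntidiagonalEquivProd) ⟨n, q⟩
  convert h6 using 1
  rw [PowerSeries.coeff_mul, Finset.sum_smul, ← Finset.sum_coe_sort]
  refine Finset.sum_congr rfl fun q _ => ?_
  obtain ⟨q, hq⟩ := q
  rw [Finset.HasAntidiagonal.mem_antidiagonal] at hq
  simp [hF, ← hq]

theorem filt_mem {f : PowerSeries 𝕜} {u : ℤ → ℋ} {t : ℤ} {M : Submodule 𝕜 ℋ}
    (hM : IsClosed (M : Set ℋ)) (h : ∀ s ≤ t, u s ∈ M) : filt f u t ∈ M := by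
  by_cases hs : Summable fun k : ℕ => PowerSeries.coeff k f • u (t - k)
  · exact hM.mem_of_tendsto hs.hasSum (Filter.Eventually.of_forall fun s =>
      M.sum_mem fun k _ => M.smul_mem _ (h _ (by simp)))
  -- The default value `0` of a divergent `tsum` lies in `M`, so no summability hypothesis is
  -- needed.
  · rw [filt, tsum_eq_zero_of_not_summable hs]; exact M.zero_mem

/-- Since `d(z) = z ^ N` times the reflected polynomial in the delay, a forward-shift action is a
causal filter read `N` steps later. -/
theorem shiftAct_eq_filt {d : 𝕜[X]} {N : ℕ} (hd : d.natDegree ≤ N) (u : ℤ → ℋ) (t : ℤ) :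
    shiftAct d u t = filt (d.reflect N : PowerSeries 𝕜) u (t + N) := by
  rw [filt_coe, shiftAct, Polynomial.sum_over_range' _ _ (N + 1) (by lia),
    Polynomial.sum_over_range' _ _ (N + 1), ← Finset.sum_range_reflect]
  · refine Finset.sum_congr rfl fun k hk => ?_
    rw [Finset.mem_range] at hk
    rw [Polynomial.coeff_reflect, Polynomial.revAt_le (by lia)]
    congr 2; push_cast [Nat.cast_sub (show k ≤ N by lia)]; ring
  · have := Polynomial.natDegree_reflect_le (p := d) (N := N)
    have := max_le hd (le_refl N)
    lia
  · simp
  · simp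

end Filter

/-! ### Left inverses of polynomial matrices with controlled denominators. -/

section LeftInverse

/-- A trivial kernel makes the row rank equal to the number of columns, and a basis of the row space
can be chosen among the rows. -/
theorem exists_det_submatrix_ne_zero {K ι κ : Type*} [Field K] [Fintype ι] [Fintype κ]
    [DecidableEq κ] (A : Matrix ι κ K) (hA : ∀ v, A.mulVec v = 0 → v = 0) :
    ∃ σ : κ → ι, (A.submatrix σ id).det ≠ 0 := by
  have hrank : Module.finrank K (Submodule.span K (Set.range A.row)) = Fintype.card κ := by
    rw [← Matrix.rank_eq_finrank_span_row, Matrix.rank]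
    rw [LinearMap.finrank_range_of_inj, Module.finrank_fintype_fun_eq_card]
    exact (injective_iff_map_eq_zero _).2 hA
  obtain ⟨f, hf, -, hli⟩ := Submodule.exists_fun_fin_finrank_span_eq K (Set.range A.row)
  choose τ hτ using hf
  let ε : κ ≃ Fin (Module.finrank K (Submodule.span K (Set.range A.row))) :=
    (Fintype.equivFin κ).trans (finCongr hrank.symm)
  refine ⟨fun j => τ (ε j), ?_⟩
  have h : LinearIndependent K (A.submatrix (fun j => τ (ε j)) id).row := by
    have h1 : (A.submatrix (fun j => τ (ε j)) id).row = f ∘ ε := funext fun j => hτ (ε j)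
    rw [h1]
    exact hli.comp ε ε.injective
  rw [Matrix.linearIndependent_rows_iff_isUnit, Matrix.isUnit_iff_isUnit_det] at h
  exact h.ne_zero

variable {𝕜 : Type*} [RCLike 𝕜] {ι κ : Type*} [Fintype ι] [Fintype κ] [DecidableEq κ]

/-- The ideal of polynomials `g` for which `g • 1` is a left multiple of `N`. -/
def leftMultipleIdeal {R : Type*} [CommRing R] (N : Matrix ι κ R) : Ideal R where
  carrier := {g | ∃ G : Matrix κ ι R, G * N = g • (1 : Matrix κ κ R)}
  add_mem' := by
    rintro a b ⟨G, hG⟩ ⟨H, hH⟩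
    exact ⟨G + H, by rw [Matrix.add_mul, hG, hH, add_smul]⟩
  zero_mem' := ⟨0, by simp⟩
  smul_mem' := by
    rintro c a ⟨G, hG⟩
    exact ⟨c • G, by rw [Matrix.smul_mul, hG, smul_eq_mul, mul_smul]⟩

theorem det_submatrix_mem_leftMultipleIdeal {R : Type*} [CommRing R] (N : Matrix ι κ R)
    (σ : κ → ι) : (N.submatrix σ id).det ∈ leftMultipleIdeal N := by
  classical
  -- The adjugate of the minor times the matrix that selects the rows `σ`.
  refine ⟨(N.submatrix σ id).adjugate * (1 : Matrix ι ι R).submatrix σ id, ?_⟩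
  rw [← Matrix.adjugate_mul, Matrix.mul_assoc]
  congr 1
  ext i j
  simp [Matrix.mul_apply, Matrix.one_apply]

/-- A polynomial matrix has a left inverse with a denominator whose zeros are zeros of the
matrix. -/
theorem exists_left_multiple (N : Matrix ι κ 𝕜[X]) :
    ∃ (g : 𝕜[X]) (G : Matrix κ ι 𝕜[X]), G * N = g • (1 : Matrix κ κ 𝕜[X]) ∧
      ∀ β : ℂ, g.eval₂ (toC 𝕜) β = 0 →
        ∃ v : κ → ℂ, v ≠ 0 ∧ (N.map fun a => a.eval₂ (toC 𝕜) β).mulVec v = 0 := by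
  -- The generator of the ideal divides every maximal minor. If it vanishes at `β`, all these minors
  -- do, so the matrix at `β` has a kernel; this replaces the Smith form.
  obtain ⟨g, hg⟩ := (IsPrincipalIdealRing.principal (leftMultipleIdeal N)).principal
  have hgmem : g ∈ leftMultipleIdeal N := by
    rw [hg]; exact Submodule.mem_span_singleton_self g
  obtain ⟨G, hG⟩ := hgmem
  refine ⟨g, G, hG, fun β hβ => ?_⟩
  by_contra! hcon
  obtain ⟨σ, hσ⟩ := exists_det_submatrix_ne_zero (N.map fun a => a.eval₂ (toC 𝕜) β)
    fun v hv => by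
      by_contra h
      exact hcon v h hv
  have hmem := det_submatrix_mem_leftMultipleIdeal N σ
  rw [hg] at hmem
  obtain ⟨q, hq⟩ := Ideal.mem_span_singleton.1 hmem
  apply hσ
  have h1 := congrArg (Polynomial.eval₂RingHom (toC 𝕜) β) hq
  rw [RingHom.map_det, map_mul, Polynomial.coe_eval₂RingHom, hβ, zero_mul] at h1
  rw [← h1]
  rfl

/-- Common denominators. -/
theorem exists_common_denom {W : Matrix ι κ (RatFunc 𝕜)} (hW : IsStable W) :
    ∃ (d : 𝕜[X]) (N : Matrix ι κ 𝕜[X]), IsStableDenom d ∧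
      ∀ i j, W i j * delayHom 𝕜 d = delayHom 𝕜 (N i j) := by
  classical
  have h : ∀ q : ι × κ, ∃ a b : 𝕜[X], IsStableDenom b ∧
      W q.1 q.2 * delayHom 𝕜 b = delayHom 𝕜 a :=
    fun q => isStableFun_iff_rep.1 (hW q.1 q.2)
  choose a b hb hab using h
  refine ⟨∏ q, b q, fun i j => a (i, j) * ∏ q ∈ Finset.univ.erase (i, j), b q, ?_, ?_⟩
  · intro β hβ
    rw [Polynomial.eval₂_finsetProd]
    exact Finset.prod_ne_zero_iff.2 fun q _ => hb q β hβ
  · intro i j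
    rw [← Finset.mul_prod_erase Finset.univ b (Finset.mem_univ (i, j)), map_mul, map_mul,
      ← hab (i, j), mul_assoc]

end LeftInverse

/-! ### Null solutions of difference equations. -/

section Recurrence

open Filter Topology

/-- The forward shift of sequences. -/
def seqShift : Module.End ℂ (ℕ → ℂ) where
  toFun c k := c (k + 1)
  map_add' _ _ := rfl
  map_smul' _ _ := rfl

theorem seqShift_pow_apply (j : ℕ) (c : ℕ → ℂ) (k : ℕ) : (seqShift ^ j) c k = c (k + j) := by
  induction j generalizing k with
  | zero => simp
  | succ j ih => rw [pow_succ', Module.End.mul_apply]; change (seqShift ^ j) c (k + 1) = _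
                 rw [ih]; congr 1; ring

theorem eq_zero_of_aeval_seqShift_eq_zero {c : ℕ → ℂ} (hc : Tendsto c atTop (𝓝 0)) {g : ℂ[X]}
    (hg : ∀ β : ℂ, ‖β‖ < 1 → g.eval β ≠ 0) (h : Polynomial.aeval seqShift g c = 0) : c = 0 := by
  have hg0 : g ≠ 0 := by rintro rfl; exact hg 0 (by simp) (by simp)
  have key : ∀ (s : Multiset ℂ) (c : ℕ → ℂ), (∀ β ∈ s, 1 ≤ ‖β‖) → Tendsto c atTop (𝓝 0) →
      Polynomial.aeval seqShift (s.map fun β => Polynomial.X - Polynomial.C β).prod c = 0 →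
      c = 0 := by
    intro s
    induction s using Multiset.induction_on with
    | empty => intro c _ _ h; simpa using h
    | cons β s ih =>
      intro c hs hc h
      rw [Multiset.map_cons, Multiset.prod_cons, mul_comm, map_mul, Module.End.mul_apply] at h
      have hlin : ∀ k, (Polynomial.aeval seqShift (Polynomial.X - Polynomial.C β) c) k =
          c (k + 1) - β * c k := by
        intro k
        simp only [map_sub, Polynomial.aeval_X, Polynomial.aeval_C]
        rfl
      have h1 := ih _ (fun x hx => hs x (Multiset.mem_cons_of_mem hx)) (by
        have h2 := ((tendsto_add_atTop_iff_nat 1).2 hc).sub (hc.const_mul β)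
        rw [mul_zero, sub_zero] at h2
        exact h2.congr fun k => (hlin k).symm) h
      have hstep : ∀ k, c (k + 1) = β * c k := fun k => by
        have h2 := congrFun h1 k
        rw [hlin] at h2
        exact sub_eq_zero.1 h2
      have hβ := hs β (Multiset.mem_cons_self _ _)
      -- With `‖β‖ ≥ 1`, including roots on the circle, the moduli of `c` cannot decrease, yet they
      -- tend to zero.
      have hmono : Monotone fun k => ‖c k‖ := monotone_nat_of_le_succ fun k => by
        rw [hstep, norm_mul]
        exact le_mul_of_one_le_left (norm_nonneg _) hβ
      have hlim : Tendsto (fun k => ‖c k‖) atTop (𝓝 0) := by simpa using hc.norm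
      ext k
      have := hmono.ge_of_tendsto hlim k
      simpa using this
  have hsplit := (IsAlgClosed.splits g).eq_prod_roots
  rw [hsplit, map_mul, Module.End.mul_apply, Polynomial.aeval_C,
    Module.algebraMap_end_apply] at h
  refine key g.roots c (fun β hβ => ?_) hc ((smul_eq_zero.1 h).resolve_left (by simpa using hg0))
  by_contra hlt
  exact hg β (not_le.1 hlt) (Polynomial.isRoot_of_mem_roots hβ)

/-- A null sequence that solves a difference equation whose characteristic polynomial has no zero
in the open unit disc vanishes. -/
theorem eq_zero_of_recurrence {𝕜 : Type*} [RCLike 𝕜] {c : ℕ → 𝕜} (hc : Tendsto c atTop (𝓝 0))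
    {g : 𝕜[X]} (hg : ∀ β : ℂ, ‖β‖ < 1 → g.eval₂ (toC 𝕜) β ≠ 0)
    (h : ∀ k, (g.sum fun j a => a * c (k + j)) = 0) : c = 0 := by
  have h1 : (fun k => toC 𝕜 (c k)) = 0 := by
    refine eq_zero_of_aeval_seqShift_eq_zero (g := g.map (toC 𝕜)) ?_
      (fun β hβ => by rw [Polynomial.eval_map]; exact hg β hβ) ?_
    · rw [tendsto_zero_iff_norm_tendsto_zero]
      simp_rw [norm_toC]
      simpa using hc.norm
    · ext k
      have h2 := congrArg (toC 𝕜) (h k)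
      rw [Polynomial.sum_def, map_sum, map_zero] at h2
      rw [Polynomial.aeval_def, Polynomial.eval₂_map, Polynomial.eval₂_eq_sum, Polynomial.sum_def,
        LinearMap.sum_apply, Finset.sum_apply, Pi.zero_apply, ← h2]
      refine Finset.sum_congr rfl fun j _ => ?_
      rw [Module.End.mul_apply, map_mul, RingHom.comp_apply, Module.algebraMap_end_apply,
        Pi.smul_apply, seqShift_pow_apply, smul_eq_mul]
  ext k
  have h2 := congrFun h1 k
  simpa using h2

end Recurrence

/-! ### Stable and minimum-phase matrices. -/

section StableMatrix

variable {𝕜 : Type*} [RCLike 𝕜] {ι κ τ : Type*}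

theorem IsStable.mul [Fintype κ] {V : Matrix ι κ (RatFunc 𝕜)} {W : Matrix κ τ (RatFunc 𝕜)} (hV : IsStable V)
    (hW : IsStable W) : IsStable (V * W) := fun i j =>
  isStableFun_sum _ fun l _ => IsStableFun.mul (hV i l) (hW l j)

theorem isStable_map_delayHom (N : Matrix ι κ 𝕜[X]) : IsStable (N.map (delayHom 𝕜)) :=
  fun i j => isStableFun_delayHom (N i j)

theorem isStable_const (K : Matrix ι κ 𝕜) : IsStable (const K) := fun i j => by
  simpa [const, IsStableFun] using isStableFun_delayHom (Polynomial.C (K i j))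

theorem impulseSeries_C (a : 𝕜) : impulseSeries (RatFunc.C a) = PowerSeries.C a := by
  rw [← delayHom_C, impulseSeries_delayHom, Polynomial.coe_C]

theorem valueAtInfinity_C (a : 𝕜) : valueAtInfinity (RatFunc.C a) = a := by
  rw [valueAtInfinity_eq_impulse, ← coeff_impulseSeries, impulseSeries_C]; simp

theorem valueAt_C (a : 𝕜) (α : ℂ) : valueAt (RatFunc.C a) α = toC 𝕜 a := by
  rw [valueAt, RatFunc.num_C, RatFunc.denom_C]; simp

/-- Removing the value at infinity and advancing by one step preserves stability. -/
theorem isStableFun_X_mul_sub {r : RatFunc 𝕜} (hr : IsStableFun r) :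
    IsStableFun (RatFunc.X * (r - RatFunc.C (valueAtInfinity r))) := by
  obtain ⟨a, b, hb, hab⟩ := isStableFun_iff_rep.1 hr
  have hval := valueAtInfinity_mul_of_rep hb.coeff_zero_ne_zero hab
  -- Subtracting the value at infinity makes the numerator vanish at `w = 0`; cancelling the factor
  -- `w` leaves the stable denominator unchanged.
  have hX : Polynomial.X ∣ a - Polynomial.C (valueAtInfinity r) * b := by
    rw [Polynomial.X_dvd_iff, Polynomial.coeff_sub, Polynomial.coeff_C_mul, hval, sub_self]
  obtain ⟨q, hq⟩ := hX
  refine isStableFun_of_rep (a := q) hb ?_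
  have h := congrArg (delayHom 𝕜) hq
  rw [map_sub, map_mul, map_mul, delayHom_X, delayHom_C, ← hab] at h
  rw [mul_assoc, sub_mul, h, ← mul_assoc, mul_inv_cancel₀ RatFunc.X_ne_zero, one_mul]

/-- At `z = β⁻¹` the matrix `W` equals `N(β) / d(β)`, so the two have the same kernel. -/
theorem isZero_of_mulVec_eq_zero [Fintype κ] {W : Matrix ι κ (RatFunc 𝕜)} {d : 𝕜[X]} {N : Matrix ι κ 𝕜[X]}
    (hrep : ∀ i j, W i j * delayHom 𝕜 d = delayHom 𝕜 (N i j)) {β : ℂ} (hβ : β ≠ 0)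
    (hd : d.eval₂ (toC 𝕜) β ≠ 0) {v : κ → ℂ} (hv : v ≠ 0)
    (h : (N.map fun a => a.eval₂ (toC 𝕜) β).mulVec v = 0) : IsZero W β⁻¹ := by
  have hd' : d.eval₂ (toC 𝕜) β⁻¹⁻¹ ≠ 0 := by rwa [inv_inv]
  refine ⟨fun i j => not_hasPoleAt_of_rep (inv_ne_zero hβ) hd' (hrep i j), v, hv, ?_⟩
  ext i
  have h1 := congrFun h i
  have h2 : ∀ j, (N i j).eval₂ (toC 𝕜) β = valueAt (W i j) β⁻¹ * d.eval₂ (toC 𝕜) β := fun j => by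
    have := valueAt_mul_of_rep (inv_ne_zero hβ) hd' (hrep i j)
    rw [inv_inv] at this
    exact this.symm
  simp only [Matrix.mulVec, dotProduct, Matrix.map_apply, Pi.zero_apply, h2] at h1 ⊢
  apply mul_right_cancel₀ hd
  rw [zero_mul, ← h1, Finset.sum_mul]
  exact Finset.sum_congr rfl fun j _ => by ring

theorem isZeroAtInfinity_of_mulVec_eq_zero [Fintype κ] {W : Matrix ι κ (RatFunc 𝕜)} {d : 𝕜[X]}
    {N : Matrix ι κ 𝕜[X]} (hrep : ∀ i j, W i j * delayHom 𝕜 d = delayHom 𝕜 (N i j))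
    (hd : d.coeff 0 ≠ 0) {v : κ → ℂ} (hv : v ≠ 0)
    (h : (N.map fun a => a.eval₂ (toC 𝕜) 0).mulVec v = 0) : IsZeroAtInfinity W := by
  refine ⟨fun i j => isProper_of_rep hd (hrep i j), v, hv, ?_⟩
  ext i
  have h1 := congrFun h i
  have h2 : ∀ j, (N i j).eval₂ (toC 𝕜) 0 = toC 𝕜 (valueAtInfinity (W i j)) *
      toC 𝕜 (d.coeff 0) := fun j => by
    rw [toC_coeff_zero, ← valueAtInfinity_mul_of_rep hd (hrep i j), map_mul]
  simp only [Matrix.mulVec, dotProduct, Matrix.map_apply, Pi.zero_apply, h2] at h1 ⊢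
  apply mul_right_cancel₀ (show toC 𝕜 (d.coeff 0) ≠ 0 by simpa using hd)
  rw [zero_mul, ← h1, Finset.sum_mul]
  exact Finset.sum_congr rfl fun j _ => by ring

/-- A minimum-phase matrix has a left inverse `g(w)⁻¹ V`, with `V` stable and all zeros of the
polynomial `g` in the closed disc at zeros of the matrix on the unit circle. -/
theorem IsMinimumPhase.exists_stable_left_multiple [Fintype ι] [Fintype κ] [DecidableEq κ] {W : Matrix ι κ (RatFunc 𝕜)}
    (hW : IsMinimumPhase W) :
    ∃ (g : 𝕜[X]) (V : Matrix κ ι (RatFunc 𝕜)), IsStable V ∧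
      V * W = delayHom 𝕜 g • (1 : Matrix κ κ (RatFunc 𝕜)) ∧
      ∀ β : ℂ, ‖β‖ ≤ 1 → g.eval₂ (toC 𝕜) β = 0 → ‖β‖ = 1 ∧ IsZero W β⁻¹ := by
  obtain ⟨d, N, hd, hrep⟩ := exists_common_denom hW.1
  obtain ⟨g, G, hG, hg⟩ := exists_left_multiple N
  -- `W = N / d` in the delay, so the factor `d` turns `G N = g I` into a polynomial left multiple
  -- of `W` itself.
  refine ⟨g, (d • G).map (delayHom 𝕜), isStable_map_delayHom _, ?_, fun β hβ hgβ => ?_⟩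
  · have h1 : (d • G).map (delayHom 𝕜) * W = (G * N).map (delayHom 𝕜) := by
      ext i j
      simp only [Matrix.mul_apply, Matrix.map_apply, Matrix.smul_apply, smul_eq_mul, map_mul,
        map_sum]
      exact Finset.sum_congr rfl fun l _ => by rw [← hrep]; ring
    rw [h1, hG]
    ext i j
    by_cases h : i = j <;> simp [h]
  · obtain ⟨v, hv, hNv⟩ := hg β hgβ
    -- The point `w = 0` is `z = ∞`, where a minimum-phase matrix has no zero.
    have hβ0 : β ≠ 0 := by
      rintro rfl
      exact hW.2.2 (isZeroAtInfinity_of_mulVec_eq_zero hrep hd.coeff_zero_ne_zero hv hNv)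
    have hz := isZero_of_mulVec_eq_zero hrep hβ0 (hd β hβ) hv hNv
    refine ⟨le_antisymm hβ ?_, hz⟩
    -- The zero `β⁻¹` is in the closed disc by minimum phase and `β` is there by assumption, so both
    -- lie on the circle.
    have h1 := hW.2.1 _ hz
    rw [norm_inv] at h1
    by_contra hlt
    exact absurd (one_lt_inv_iff₀.2 ⟨norm_pos_iff.2 hβ0, not_le.1 hlt⟩) (not_lt.2 h1)

end StableMatrix

/-! ### Outputs of stable systems, cascades and pasts. -/

section Output

variable {𝕜 : Type*} [RCLike 𝕜] {ℋ : Type*} [NormedAddCommGroup ℋ] [InnerProductSpace 𝕜 ℋ]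
  {ι κ τ : Type*}

theorem IsStable.absSummable {W : Matrix ι κ (RatFunc 𝕜)} (hW : IsStable W) (i : ι) (j : κ) :
    AbsSummable (impulseSeries (W i j)) := absSummable_impulseSeries (hW i j)

theorem isOutput_iff [Fintype κ] [CompleteSpace ℋ] {W : Matrix ι κ (RatFunc 𝕜)} (hW : IsStable W)
    {u : ℤ → κ → ℋ} (hu : ∀ j, BoundedProcess fun t => u t j) {x : ℤ → ι → ℋ} :
    IsOutput W u x ↔
      ∀ t i, x t i = ∑ j, filt (impulseSeries (W i j)) (fun s => u s j) t := by
  have h : ∀ t i, HasSum (fun k : ℕ => ∑ j, impulse (W i j) k • u (t - k) j)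
      (∑ j, filt (impulseSeries (W i j)) (fun s => u s j) t) := fun t i =>
    hasSum_sum fun j _ => hasSum_filt (hW.absSummable i j) (hu j) t
  exact ⟨fun hx t i => (hx t i).unique (h t i), fun hx t i => hx t i ▸ h t i⟩

theorem IsOutput.boundedProcess [Fintype κ] [CompleteSpace ℋ] {W : Matrix ι κ (RatFunc 𝕜)} (hW : IsStable W)
    {u : ℤ → κ → ℋ} (hu : ∀ j, BoundedProcess fun t => u t j) {x : ℤ → ι → ℋ}
    (hx : IsOutput W u x) (i : ι) : BoundedProcess fun t => x t i := by
  simp_rw [(isOutput_iff hW hu).1 hx]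
  exact BoundedProcess.sum _ fun j => boundedProcess_filt (hW.absSummable i j) (hu j)

/-- The cascade rule: matrix multiplication of transfer functions becomes composition of filters. -/
theorem sum_filt_output [Fintype κ] [Fintype τ] [CompleteSpace ℋ] {W : Matrix κ τ (RatFunc 𝕜)} {V : Matrix ι κ (RatFunc 𝕜)}
    (hW : IsStable W) (hV : IsStable V) {u : ℤ → τ → ℋ} (hu : ∀ j, BoundedProcess fun t => u t j)
    {x : ℤ → κ → ℋ} (hx : IsOutput W u x) (t : ℤ) (i : ι) :
    ∑ l, filt (impulseSeries (V i l)) (fun s => x s l) t =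
      ∑ j, filt (impulseSeries ((V * W) i j)) (fun s => u s j) t := by
  simp_rw [(isOutput_iff hW hu).1 hx]
  have h1 : ∀ l, filt (impulseSeries (V i l))
      (fun s => ∑ j, filt (impulseSeries (W l j)) (fun s => u s j) s) t =
      ∑ j, filt (impulseSeries (V i l) * impulseSeries (W l j)) (fun s => u s j) t := fun l => by
    rw [filt_sum_process _ (hV.absSummable i l)
      fun j => boundedProcess_filt (hW.absSummable l j) (hu j)]
    exact Finset.sum_congr rfl fun j _ =>
      (filt_mul_apply (hV.absSummable i l) (hW.absSummable l j) (hu j) t).symm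
  simp_rw [h1]
  rw [Finset.sum_comm]
  refine Finset.sum_congr rfl fun j _ => ?_
  rw [Matrix.mul_apply, impulseSeries_sum _ fun l _ => IsStableFun.mul (hV i l) (hW l j),
    ← filt_sum_apply _ (fun l => (hV.absSummable i l).mul (hW.absSummable l j)) (hu j)]
  congr 1
  exact Finset.sum_congr rfl fun l _ => (impulseSeries_mul (hV i l).1 (hW l j).1).symm

theorem isOutput_mul_iff [Fintype κ] [Fintype τ] [CompleteSpace ℋ] {W : Matrix κ τ (RatFunc 𝕜)}
    {V : Matrix ι κ (RatFunc 𝕜)} (hW : IsStable W) (hV : IsStable V) {u : ℤ → τ → ℋ}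
    (hu : ∀ j, BoundedProcess fun t => u t j) {x : ℤ → κ → ℋ} (hx : IsOutput W u x)
    {y : ℤ → ι → ℋ} : IsOutput (V * W) u y ↔ IsOutput V x y := by
  rw [isOutput_iff (hV.mul hW) hu, isOutput_iff hV (hx.boundedProcess hW hu)]
  simp_rw [sum_filt_output hW hV hu hx]

theorem IsOutput.shift [Fintype κ] {W : Matrix ι κ (RatFunc 𝕜)} {u : ℤ → κ → ℋ} {x : ℤ → ι → ℋ}
    (hx : IsOutput W u x) (n : ℤ) : IsOutput W (fun t => u (t - n)) (fun t => x (t - n)) := by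
  intro t i
  simpa only [sub_right_comm] using hx (t - n) i

theorem isOutput_const [Fintype κ] (K : Matrix ι κ 𝕜) (u : ℤ → κ → ℋ) :
    IsOutput (const K) u fun t i => ∑ j, K i j • u t j := by
  intro t i
  have h0 : ∀ j, impulse (const K i j) 0 = K i j := fun j => by
    rw [← valueAtInfinity_eq_impulse]; exact valueAtInfinity_C _
  have h := hasSum_single (f := fun k : ℕ => ∑ j, impulse (const K i j) k • u (t - k) j) 0
    fun k hk => by
      refine Finset.sum_eq_zero fun j _ => ?_
      rw [← coeff_impulseSeries, const, Matrix.map_apply, impulseSeries_C, PowerSeries.coeff_C,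
        if_neg hk, zero_smul]
  simpa [h0] using h

theorem IsOutput.add [Fintype κ] {V W : Matrix ι κ (RatFunc 𝕜)} (hV : IsStable V) (hW : IsStable W)
    {u : ℤ → κ → ℋ} {x y : ℤ → ι → ℋ} (hx : IsOutput V u x) (hy : IsOutput W u y) :
    IsOutput (V + W) u fun t i => x t i + y t i := by
  intro t i
  convert (hx t i).add (hy t i) using 2 with k
  rw [← Finset.sum_add_distrib]
  refine Finset.sum_congr rfl fun j _ => ?_
  rw [← add_smul, Matrix.add_apply]
  simp_rw [← coeff_impulseSeries]
  rw [impulseSeries_add (hV i j).1 (hW i j).1, map_add]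

/-- A delayed input is the same as a delayed transfer function. -/
theorem isOutput_delay [Fintype κ] {W : Matrix ι κ (RatFunc 𝕜)} (hW : IsStable W) {u : ℤ → κ → ℋ}
    {x : ℤ → ι → ℋ} (hx : IsOutput W (fun t => u (t - 1)) x) :
    IsOutput ((RatFunc.X⁻¹ : RatFunc 𝕜) • W) u x := by
  have hser : ∀ i j, impulseSeries ((RatFunc.X⁻¹ : RatFunc 𝕜) * W i j) =
      PowerSeries.X * impulseSeries (W i j) := fun i j => by
    rw [← delayHom_X, impulseSeries_mul (isStableFun_delayHom _).1 (hW i j).1,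
      impulseSeries_delayHom, Polynomial.coe_X]
  intro t i
  -- The delayed transfer function has zero coefficient at index `0`, so dropping that term shifts
  -- the series by one.
  rw [← hasSum_nat_add_iff' 1]
  convert hx t i using 2 with k
  · refine Finset.sum_congr rfl fun j _ => ?_
    rw [← coeff_impulseSeries, Matrix.smul_apply, smul_eq_mul, hser,
      PowerSeries.coeff_succ_X_mul, coeff_impulseSeries]
    congr 2; push_cast; ring
  · rw [Finset.sum_range_one]
    simp only [← coeff_impulseSeries, Matrix.smul_apply, smul_eq_mul, hser,
      PowerSeries.coeff_zero_X_mul, zero_smul, Finset.sum_const_zero, sub_zero]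

/-! ### Pasts -/

theorem mem_past {u : ℤ → κ → ℋ} {s t : ℤ} (hst : s ≤ t) (j : κ) : u s j ∈ past 𝕜 u t :=
  Submodule.le_topologicalClosure _ (Submodule.subset_span ⟨s, hst, j, rfl⟩)

theorem isClosed_past (u : ℤ → κ → ℋ) (t : ℤ) : IsClosed (past 𝕜 u t : Set ℋ) :=
  Submodule.isClosed_topologicalClosure _

theorem past_le_iff {u : ℤ → κ → ℋ} {t : ℤ} {M : Submodule 𝕜 ℋ} (hM : IsClosed (M : Set ℋ)) :
    past 𝕜 u t ≤ M ↔ ∀ s ≤ t, ∀ j, u s j ∈ M := by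
  refine ⟨fun h s hs j => h (mem_past hs j), fun h => ?_⟩
  refine Submodule.topologicalClosure_minimal _ (Submodule.span_le.2 ?_) hM
  rintro _ ⟨s, hs, j, rfl⟩
  exact h s hs j

theorem IsOutput.mem_past [Fintype κ] {W : Matrix ι κ (RatFunc 𝕜)} {u : ℤ → κ → ℋ} {x : ℤ → ι → ℋ}
    (hx : IsOutput W u x) {s t : ℤ} (hst : s ≤ t) (i : ι) : x s i ∈ past 𝕜 u t :=
  (isClosed_past u t).mem_of_tendsto (hx s i) (Filter.Eventually.of_forall fun _ =>
    Submodule.sum_mem _ fun _ _ => Submodule.sum_mem _ fun _ _ =>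
      Submodule.smul_mem _ _ (LowRank.mem_past (by lia) _))

theorem past_shift (u : ℤ → κ → ℋ) (n t : ℤ) :
    past 𝕜 (fun s => u (s - n)) t = past 𝕜 u (t - n) := by
  apply le_antisymm
  · exact (past_le_iff (isClosed_past _ _)).2 fun s hs j => mem_past (by lia) j
  · refine (past_le_iff (isClosed_past _ _)).2 fun s hs j => ?_
    simpa using mem_past (𝕜 := 𝕜) (u := fun s => u (s - n)) (s := s + n) (t := t) (by lia) j

theorem mem_orthogonal_past_iff {u : ℤ → κ → ℋ} {t : ℤ} {x : ℋ} :
    x ∈ (past 𝕜 u t)ᗮ ↔ ∀ s ≤ t, ∀ j, inner 𝕜 (u s j) x = 0 := by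
  refine ⟨fun h s hs j => h _ (mem_past hs j), fun h => ?_⟩
  -- The orthogonal complement of `x` is closed, so orthogonality to the generators passes to the
  -- closed span.
  have h1 : past 𝕜 u t ≤ (Submodule.span 𝕜 {x})ᗮ := by
    refine (past_le_iff (Submodule.isClosed_orthogonal _)).2 fun s hs j => ?_
    rw [Submodule.mem_orthogonal_singleton_iff_inner_left]
    exact h s hs j
  intro y hy
  exact Submodule.mem_orthogonal_singleton_iff_inner_left.1 (h1 hy)

end Output

/-! ### White-noise inputs and equality of pasts. -/

section WhiteNoise

open Filter Topology

variable {𝕜 : Type*} [RCLike 𝕜] {ℋ : Type*} [NormedAddCommGroup ℋ] [InnerProductSpace 𝕜 ℋ]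
  {ι κ : Type*} {e : ℤ → κ → ℋ}

theorem boundedProcess_of_orthonormal (he : Orthonormal 𝕜 fun q : ℤ × κ => e q.1 q.2) (j : κ) :
    BoundedProcess fun t => e t j := ⟨1, fun t => (he.1 (t, j)).le⟩

theorem orthonormal_shift (he : Orthonormal 𝕜 fun q : ℤ × κ => e q.1 q.2) (n : ℤ) :
    Orthonormal 𝕜 fun q : ℤ × κ => e (q.1 - n) q.2 :=
  he.comp (fun q : ℤ × κ => (q.1 - n, q.2)) fun q q' h => by
    simp only [Prod.mk.injEq] at h
    exact Prod.ext (by lia) h.2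

theorem mem_orthogonal_past_of_orthonormal (he : Orthonormal 𝕜 fun q : ℤ × κ => e q.1 q.2)
    {s t : ℤ} (hst : s < t) (j : κ) : e t j ∈ (past 𝕜 e s)ᗮ :=
  mem_orthogonal_past_iff.2 fun r hr i =>
    he.2 (i := (r, i)) (j := (t, j)) fun h => by
      simp only [Prod.mk.injEq] at h; lia

/-- Orthonormality of the noise leaves a single term of the series. This is how a transfer function
is read off from its output. -/
theorem IsOutput.inner_eq_impulse [Fintype κ] (he : Orthonormal 𝕜 fun q : ℤ × κ => e q.1 q.2)
    {V : Matrix ι κ (RatFunc 𝕜)} {x : ℤ → ι → ℋ} (hx : IsOutput V e x) (t : ℤ) (k : ℕ) (i : ι)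
    (j : κ) : inner 𝕜 (e (t - k) j) (x t i) = impulse (V i j) k := by
  classical
  have h := (hx t i).mapL (innerSL 𝕜 (e (t - k) j))
  simp only [innerSL_apply_apply, inner_sum, inner_smul_right] at h
  have hite := orthonormal_iff_ite.1 he
  have h0 : ∀ k' : ℕ, ∀ j', inner 𝕜 (e (t - k) j) (e (t - k') j') =
      if k = k' ∧ j = j' then (1 : 𝕜) else 0 := fun k' j' => by
    rw [hite (t - k, j) (t - k', j')]
    simp
  simp only [h0] at h
  refine h.unique ?_
  convert hasSum_single k fun k' hk' => ?_ using 1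
  · simp
  · simp [Ne.symm hk']

theorem IsOutput.transfer_unique [Fintype κ] (he : Orthonormal 𝕜 fun q : ℤ × κ => e q.1 q.2)
    {V V' : Matrix ι κ (RatFunc 𝕜)} (hV : IsStable V) (hV' : IsStable V') {x : ℤ → ι → ℋ}
    (hx : IsOutput V e x) (hx' : IsOutput V' e x) : V = V' := by
  ext i j : 2
  refine impulseSeries_injOn (hV i j).1 (hV' i j).1 ?_
  ext k
  rw [coeff_impulseSeries, coeff_impulseSeries, ← hx.inner_eq_impulse he 0,
    ← hx'.inner_eq_impulse he 0]

/-- Bessel's inequality makes the squares summable along any injective sequence of indices. -/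
theorem tendsto_inner_orthonormal (he : Orthonormal 𝕜 fun q : ℤ × κ => e q.1 q.2) (x : ℋ) (t : ℤ)
    (j : κ) : Tendsto (fun k : ℕ => inner 𝕜 x (e (t - k) j)) atTop (𝓝 0) := by
  have h1 := (he.inner_products_summable x).comp_injective
    (i := fun k : ℕ => ((t - k, j) : ℤ × κ)) fun k k' h => by
      simp only [Prod.mk.injEq] at h; lia
  have h2 := h1.tendsto_atTop_zero.sqrt
  simp only [Function.comp_apply, Real.sqrt_zero, Real.sqrt_sq (norm_nonneg _)] at h2
  rw [tendsto_zero_iff_norm_tendsto_zero]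
  simpa only [norm_inner_symm] using h2

/-- The past of the output of a minimum-phase system driven by white noise is the past of the
noise. -/
theorem IsMinimumPhase.past_eq [Fintype κ] [CompleteSpace ℋ] [Fintype ι] {W : Matrix ι κ (RatFunc 𝕜)}
    (hW : IsMinimumPhase W) (he : Orthonormal 𝕜 fun q : ℤ × κ => e q.1 q.2) {y : ℤ → ι → ℋ}
    (hy : IsOutput W e y) (t : ℤ) : past 𝕜 e t = past 𝕜 y t := by
  classical
  apply le_antisymm _ ((past_le_iff (isClosed_past _ _)).2 fun s hs i => hy.mem_past hs i)
  -- The past is complete, so it is its own double complement, and it suffices to test against every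
  -- `x` orthogonal to it.
  rw [← Submodule.orthogonal_orthogonal (past 𝕜 y t)]
  refine (past_le_iff (Submodule.isClosed_orthogonal _)).2 fun s hs j => ?_
  obtain ⟨g, V, hV, hVW, hg⟩ := hW.exists_stable_left_multiple
  have hbd := boundedProcess_of_orthonormal he
  -- Filtering `y` by the `j`-th row of `V` produces `g(w) e_j`, causally in `y`.
  have hmem : ∀ s ≤ t, filt (g : PowerSeries 𝕜) (fun s => e s j) s ∈ past 𝕜 y t := by
    intro s hs
    have h1 := sum_filt_output hW.1 hV hbd hy s j
    rw [hVW, Finset.sum_eq_single j] at h1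
    · simp only [Matrix.smul_apply, Matrix.one_apply_eq, smul_eq_mul, mul_one,
        impulseSeries_delayHom] at h1
      rw [← h1]
      exact Submodule.sum_mem _ fun l _ => filt_mem (isClosed_past _ _) fun r hr =>
        mem_past (hr.trans hs) l
    · intro l _ hl
      simp only [Matrix.smul_apply, Matrix.one_apply_ne hl.symm, smul_zero]
      have h0 : impulseSeries (0 : RatFunc 𝕜) = 0 := by
        simpa using impulseSeries_delayHom (0 : 𝕜[X])
      simp [h0, filt]
    · simp
  intro x hx
  have hc := eq_zero_of_recurrence (tendsto_inner_orthonormal he x s j) (g := g)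
    (fun β hβ h0 => hβ.ne (hg β hβ.le h0).1) fun k => by
      have h1 := (Submodule.mem_orthogonal' _ _).1 hx _ (hmem (s - k) (by lia))
      rw [filt_coe, Polynomial.sum_def, inner_sum] at h1
      rw [Polynomial.sum_def, ← h1]
      refine Finset.sum_congr rfl fun l _ => ?_
      rw [inner_smul_right]
      congr 3; push_cast; ring
  simpa using congrFun hc 0

end WhiteNoise

/-! ### Difference equations, the strictly causal part and the predictor. -/

section Feedback

variable {𝕜 : Type*} [RCLike 𝕜] {ℋ : Type*} [NormedAddCommGroup ℋ] [InnerProductSpace 𝕜 ℋ]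
  {ι κ τ : Type*}

theorem sum_filt_single [Fintype κ] (f : κ → PowerSeries 𝕜) (i : κ) (u : κ → ℤ → ℋ) (t : ℤ)
    (hf : ∀ j ≠ i, f j = 0) : ∑ j, filt (f j) (u j) t = filt (f i) (u i) t := by
  classical
  refine Finset.sum_eq_single i (fun j _ hj => ?_) (by simp)
  simp [hf j hj, filt]

/-- A factorization of transfer functions gives difference equations for the outputs. -/
theorem isDifferenceOutput_of_eq_mul [CompleteSpace ℋ] [Fintype ι] [Fintype κ] [Fintype τ] [DecidableEq ι]
    {H : Matrix ι κ (RatFunc 𝕜)} {W₁ : Matrix κ τ (RatFunc 𝕜)} {W₂ : Matrix ι τ (RatFunc 𝕜)}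
    (h₁ : IsStable W₁) (h₂ : IsStable W₂) (hH : W₂ = H * W₁) {u : ℤ → τ → ℋ}
    (hu : ∀ j, BoundedProcess fun t => u t j) {y₁ : ℤ → κ → ℋ} {y₂ : ℤ → ι → ℋ}
    (hy₁ : IsOutput W₁ u y₁) (hy₂ : IsOutput W₂ u y₂) : IsDifferenceOutput H y₁ y₂ := by
  intro d N hdN t i
  set n := d.natDegree + ∑ q : ι × κ, (N q.1 q.2).natDegree
  have hd : d.natDegree ≤ n := Nat.le_add_right _ _
  have hN : ∀ i j, (N i j).natDegree ≤ n := fun i j =>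
    (Finset.single_le_sum (f := fun q : ι × κ => (N q.1 q.2).natDegree) (fun _ _ => Nat.zero_le _)
      (Finset.mem_univ (i, j))).trans (Nat.le_add_left _ _)
  set D : Matrix ι ι 𝕜[X] := Matrix.diagonal fun _ => d.reflect n
  set M : Matrix ι κ 𝕜[X] := N.map fun a => a.reflect n
  -- Multiplying by `w ^ n` turns `d H = N` into an identity between polynomials in the delay, so
  -- only stable filters act and `H` itself is never applied.
  have hX : (RatFunc.X : RatFunc 𝕜) ^ n ≠ 0 := pow_ne_zero _ RatFunc.X_ne_zero
  have hDH : ∀ i j, delayHom 𝕜 (d.reflect n) * H i j = delayHom 𝕜 ((N i j).reflect n) := by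
    intro i j
    apply mul_right_cancel₀ hX
    rw [delayHom_reflect_mul_pow (hN i j), ← hdN, ← delayHom_reflect_mul_pow hd]
    ring
  have hDM : D.map (delayHom 𝕜) * W₂ = M.map (delayHom 𝕜) * W₁ := by
    have h : D.map (delayHom 𝕜) * H = M.map (delayHom 𝕜) := by
      ext i j
      rw [Matrix.diagonal_map (map_zero _), Matrix.diagonal_mul]
      exact hDH i j
    rw [hH, ← Matrix.mul_assoc, h]
  have key := sum_filt_output h₂ (isStable_map_delayHom D) hu hy₂ (t + n) i
  rw [hDM, ← sum_filt_output h₁ (isStable_map_delayHom M) hu hy₁ (t + n) i] at key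
  simp only [Matrix.map_apply, impulseSeries_delayHom] at key
  rw [sum_filt_single _ i _ _ fun j hj => by simp [D, Matrix.diagonal_apply_ne' _ hj]] at key
  rw [shiftAct_eq_filt hd]
  simp_rw [shiftAct_eq_filt (hN i _)]
  simpa [D, M] using key

/-- The advanced strictly causal part `z (W - W(∞))` of a stable matrix. -/
noncomputable def advance (W : Matrix ι κ (RatFunc 𝕜)) : Matrix ι κ (RatFunc 𝕜) :=
  (RatFunc.X : RatFunc 𝕜) • (W - const (W.map valueAtInfinity))

theorem isStable_advance {W : Matrix ι κ (RatFunc 𝕜)} (hW : IsStable W) : IsStable (advance W) :=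
  fun i j => isStableFun_X_mul_sub (hW i j)

theorem eq_delay_advance_add_const (W : Matrix ι κ (RatFunc 𝕜)) :
    W = (RatFunc.X⁻¹ : RatFunc 𝕜) • advance W + const (W.map valueAtInfinity) := by
  rw [advance, smul_smul, inv_mul_cancel₀ RatFunc.X_ne_zero, one_smul, sub_add_cancel]

/-- A constant matrix takes the value `W(∞)` everywhere, so a zero at any point would be a zero of
`W` at infinity. -/
theorem isMinimumPhase_const_valueAtInfinity [Fintype κ] {W : Matrix ι κ (RatFunc 𝕜)} (hW : IsStable W)
    (h : ¬ IsZeroAtInfinity W) : IsMinimumPhase (const (W.map valueAtInfinity)) := by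
  refine ⟨isStable_const _, fun α hα => ?_, fun h0 => ?_⟩
  · obtain ⟨-, v, hv, hv0⟩ := hα
    refine absurd ⟨fun i j => (hW i j).1, v, hv, ?_⟩ h
    convert hv0 using 2
    ext i j
    simp [const, valueAt_C]
  · obtain ⟨-, v, hv, hv0⟩ := h0
    refine h ⟨fun i j => (hW i j).1, v, hv, ?_⟩
    convert hv0 using 2
    ext i j
    simp [const, valueAtInfinity_C]

/-- If the past of the noise is the past of `y₂`, the one-step predictor of `W e` based on the
strict past of `y₂` is the output of the strictly causal part of `W`. -/
theorem wienerPredictor_spec [Fintype κ] [CompleteSpace ℋ] {e : ℤ → κ → ℋ}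
    (he : Orthonormal 𝕜 fun q : ℤ × κ => e q.1 q.2) {W : Matrix ι κ (RatFunc 𝕜)}
    (hW : IsStable W) {y : ℤ → ι → ℋ} (hy : IsOutput W e y) {y₂ : ℤ → τ → ℋ}
    (hpast : ∀ t, past 𝕜 e t = past 𝕜 y₂ t) :
    IsOutput (advance W) (fun t => e (t - 1)) (wienerPredictor 𝕜 y₂ y) ∧
      ∀ t i, y t i - wienerPredictor 𝕜 y₂ y t i = ∑ j, valueAtInfinity (W i j) • e t j := by
  have hbd := boundedProcess_of_orthonormal (e := fun t => e (t - 1))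
    (orthonormal_shift he 1)
  set x : ℤ → ι → ℋ := fun t i =>
    ∑ j, filt (impulseSeries (advance W i j)) (fun s => e (s - 1) j) t with hxdef
  have hx : IsOutput (advance W) (fun t => e (t - 1)) x :=
    (isOutput_iff (isStable_advance hW) hbd).2 fun _ _ => rfl
  have hdelay : IsStable ((RatFunc.X⁻¹ : RatFunc 𝕜) • advance W) := fun i j => by
    rw [Matrix.smul_apply, smul_eq_mul, ← delayHom_X]
    exact IsStableFun.mul (isStableFun_delayHom _) (isStable_advance hW i j)
  have hsum := IsOutput.add hdelay (isStable_const _)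
    (isOutput_delay (isStable_advance hW) hx) (isOutput_const (W.map valueAtInfinity) e)
  rw [← eq_delay_advance_add_const] at hsum
  have hyx : ∀ t i, y t i = x t i + ∑ j, valueAtInfinity (W i j) • e t j := fun t i =>
    (hy t i).unique (hsum t i)
  -- `x(t)` is a causal function of `e(t - 1)`, hence lies in the strict past, and the remainder
  -- involves only `e(t)`, which is orthogonal to it.
  have hpred : wienerPredictor 𝕜 y₂ y = x := by
    funext t i
    refine Submodule.eq_starProjection_of_mem_orthogonal' (z := ∑ j, valueAtInfinity (W i j) • e t j)
      ?_ ?_ (hyx t i)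
    · rw [← hpast, ← past_shift]
      exact hx.mem_past le_rfl i
    · rw [← hpast]
      exact Submodule.sum_mem _ fun j _ => Submodule.smul_mem _ _
        (mem_orthogonal_past_of_orthonormal he (by lia) j)
  rw [hpred]
  exact ⟨hx, fun t i => by rw [hyx, add_sub_cancel_left]⟩

/-- Causality puts `x(t)` in the strict past of `y₂` and `v(t)` is orthogonal to it, which
characterizes the projection. -/
theorem wienerPredictor_unique [Fintype κ] [CompleteSpace ℋ] {y₂ : ℤ → κ → ℋ}
    {F : Matrix τ κ (RatFunc 𝕜)} {y x v : ℤ → τ → ℋ}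
    (hx : IsOutput F (fun t => y₂ (t - 1)) x) (hy : ∀ t i, y t i = x t i + v t i)
    (hv : UncorrelatedWithStrictPast 𝕜 v y₂) : x = wienerPredictor 𝕜 y₂ y := by
  funext t i
  refine (Submodule.eq_starProjection_of_mem_orthogonal' ?_ (hv t i) (hy t i)).symm
  rw [← past_shift]
  exact hx.mem_past le_rfl i

end Feedback

end LowRank

/-! ### The feedback representation and its uniqueness. -/

theorem theoremA2 {𝕜 : Type*} [RCLike 𝕜] {Ω : Type*} [MeasurableSpace Ω]
    (μ : MeasureTheory.Measure Ω) [MeasureTheory.IsProbabilityMeasure μ] (m p : ℕ)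
    (W₁ : Matrix (Fin m) (Fin m) (RatFunc 𝕜)) (W₂ : Matrix (Fin p) (Fin m) (RatFunc 𝕜))
    (e : ℤ → Fin m → MeasureTheory.Lp 𝕜 2 μ)
    (y₁ : ℤ → Fin m → MeasureTheory.Lp 𝕜 2 μ) (y₂ : ℤ → Fin p → MeasureTheory.Lp 𝕜 2 μ)
    -- the innovation model `y = W(z) e` of the joint process, with `W` minimum-phase
    (hW : LowRank.IsMinimumPhase (Matrix.fromRows W₁ W₂)) (hW₁ : W₁.det ≠ 0)
    (he : LowRank.IsNormalizedWhiteNoise e)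
    (hy₁ : LowRank.IsOutput W₁ e y₁) (hy₂ : LowRank.IsOutput W₂ e y₂)
    -- the assumption of the theorem
    (hW₂ : LowRank.IsMinimumPhase W₂) :
    -- `e` is the innovation of `y`, and it is uncorrelated with the strict past of `y₂`
    LowRank.IsInnovation e (fun t => Sum.elim (y₁ t) (y₂ t)) ∧
    LowRank.UncorrelatedWithStrictPast 𝕜 e y₂ ∧
    -- the return path `y₂ = H(z) y₁` of the feedback model
    (∃ H : Matrix (Fin p) (Fin m) (RatFunc 𝕜),
      W₂ = H * W₁ ∧ LowRank.IsDifferenceOutput H y₁ y₂) ∧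
    -- the forward loop `y₁ = z⁻¹ F(z) y₂ + K e`, with constant `K`
    ∃ (F : Matrix (Fin m) (Fin p) (RatFunc 𝕜)) (K : Matrix (Fin m) (Fin m) 𝕜),
      -- `F` is causal, and in `{|z| ≥ 1}` it can have poles only at zeros of `W₂` (which are on
      -- the unit circle); it is stable if there are no such zeros
      (∀ i j, LowRank.IsProper (F i j)) ∧
      (∀ α : ℂ, 1 ≤ ‖α‖ → ∀ i j, LowRank.HasPoleAt (F i j) α →
        ‖α‖ = 1 ∧ LowRank.IsZero W₂ α) ∧
      ((∀ α : ℂ, ‖α‖ = 1 → ¬ LowRank.IsZero W₂ α) → LowRank.IsStable F) ∧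
      -- the representation as an identity of transfer functions
      W₁ = (RatFunc.X⁻¹ : RatFunc 𝕜) • (F * W₂) + LowRank.const K ∧
      (¬ LowRank.IsZeroAtInfinity W₁ → LowRank.IsMinimumPhase (LowRank.const K)) ∧
      -- the prediction error is `K e(t)`
      (∀ t i, y₁ t i - LowRank.wienerPredictor 𝕜 y₂ y₁ t i = ∑ j, K i j • e t j) ∧
      -- the predictor is `F(z) y₂(t-1)`; with poles on the circle this means `(F W₂)(z) e(t-1)`
      LowRank.IsStable (F * W₂) ∧
      LowRank.IsOutput (F * W₂) (fun t => e (t - 1)) (LowRank.wienerPredictor 𝕜 y₂ y₁) ∧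
      (LowRank.IsStable F →
        LowRank.IsOutput F (fun t => y₂ (t - 1)) (LowRank.wienerPredictor 𝕜 y₂ y₁)) ∧
      -- uniqueness: let `y₁(t) = F'(z) y₂(t-1) + v(t)` with `F'` causal and stable and the noise
      -- term `v(t)` uncorrelated with the strict past of `y₂`
      ∀ (F' : Matrix (Fin m) (Fin p) (RatFunc 𝕜)) (x v : ℤ → Fin m → MeasureTheory.Lp 𝕜 2 μ),
        LowRank.IsStable F' → LowRank.IsOutput F' (fun t => y₂ (t - 1)) x →
        (∀ t i, y₁ t i = x t i + v t i) → LowRank.UncorrelatedWithStrictPast 𝕜 v y₂ →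
        x = LowRank.wienerPredictor 𝕜 y₂ y₁ ∧
        (∀ t i, v t i = ∑ j, K i j • e t j) ∧
        F' * W₂ = F * W₂ ∧ (p = m → F' = F) ∧
        ∀ K' : Matrix (Fin m) (Fin m) (RatFunc 𝕜), LowRank.IsStable K' →
          LowRank.IsOutput K' e v → K' = LowRank.const K := by
  have horth := he.orthonormal
  have hbd := LowRank.boundedProcess_of_orthonormal horth
  have hbd' := LowRank.boundedProcess_of_orthonormal (e := fun t => e (t - 1))
    (LowRank.orthonormal_shift horth 1)
  have hs₁ : LowRank.IsStable W₁ := fun i j => hW.1 (Sum.inl i) j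
  have hs₂ := hW₂.1
  have hy : LowRank.IsOutput (Matrix.fromRows W₁ W₂) e fun t => Sum.elim (y₁ t) (y₂ t) := by
    rintro t (i | i)
    · exact hy₁ t i
    · exact hy₂ t i
  have hpast := hW₂.past_eq horth hy₂
  have hunc : LowRank.UncorrelatedWithStrictPast 𝕜 e y₂ := fun t j => by
    rw [← hpast]
    exact LowRank.mem_orthogonal_past_of_orthonormal horth (by lia) j
  have hH : W₂ = W₂ * W₁⁻¹ * W₁ := by
    rw [Matrix.mul_assoc, Matrix.nonsing_inv_mul _ (isUnit_iff_ne_zero.2 hW₁), Matrix.mul_one]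
  refine ⟨⟨he, hW.past_eq horth hy⟩, hunc, ⟨W₂ * W₁⁻¹, hH,
    LowRank.isDifferenceOutput_of_eq_mul hs₁ hs₂ hH hbd hy₁ hy₂⟩, ?_⟩
  obtain ⟨g, V, hV, hVW, hg⟩ := hW₂.exists_stable_left_multiple
  -- Zeros of `g` in the closed disc have modulus one, so `g(0) ≠ 0` and dividing by `g(w)`
  -- preserves causality.
  have hg0 : g.eval₂ (LowRank.toC 𝕜) 0 ≠ 0 := fun h0 => by
    simpa using (hg 0 (by simp) h0).1
  have hgc := LowRank.coeff_zero_ne_zero_of_eval₂ hg0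
  have hgφ : LowRank.delayHom 𝕜 g ≠ 0 := by
    rw [Ne, map_eq_zero_iff _ LowRank.delayHom_injective]
    rintro rfl
    simp at hgc
  set L : Matrix (Fin m) (Fin p) (RatFunc 𝕜) := (LowRank.delayHom 𝕜 g)⁻¹ • V with hL
  have hLW : L * W₂ = 1 := by
    rw [hL, Matrix.smul_mul, hVW, smul_smul, inv_mul_cancel₀ hgφ, one_smul]
  set F := LowRank.advance W₁ * L with hF
  have hFW : F * W₂ = LowRank.advance W₁ := by rw [hF, Matrix.mul_assoc, hLW, Matrix.mul_one]
  have hadv := LowRank.isStable_advance hs₁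
  -- Up to the stable denominator `b`, the denominator of `F` is `g`; hence poles of `F` in `‖z‖ ≥
  -- 1` come only from zeros of `g`.
  have hFrep : ∀ i j, ∃ a b : 𝕜[X], LowRank.IsStableDenom b ∧
      F i j * LowRank.delayHom 𝕜 (g * b) = LowRank.delayHom 𝕜 a := by
    intro i j
    obtain ⟨a, b, hb, hab⟩ := LowRank.isStableFun_iff_rep.1 (hadv.mul hV i j)
    refine ⟨a, b, hb, ?_⟩
    rw [← hab, map_mul, hF, hL, Matrix.mul_smul, Matrix.smul_apply, smul_eq_mul]
    field_simp
  have hFproper : ∀ i j, LowRank.IsProper (F i j) := by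
    intro i j
    obtain ⟨a, b, hb, hab⟩ := hFrep i j
    exact LowRank.isProper_of_rep
      (by rw [Polynomial.mul_coeff_zero]; exact mul_ne_zero hgc hb.coeff_zero_ne_zero) hab
  have hFpole : ∀ α : ℂ, 1 ≤ ‖α‖ → ∀ i j, LowRank.HasPoleAt (F i j) α →
      ‖α‖ = 1 ∧ LowRank.IsZero W₂ α := by
    intro α hα i j hpole
    have hα0 : α ≠ 0 := norm_pos_iff.1 (zero_lt_one.trans_le hα)
    have hα' : ‖α⁻¹‖ ≤ 1 := by rw [norm_inv]; exact inv_le_one_of_one_le₀ hα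
    obtain ⟨a, b, hb, hab⟩ := hFrep i j
    by_cases hgα : g.eval₂ (LowRank.toC 𝕜) α⁻¹ = 0
    · have h := hg _ hα' hgα
      rwa [norm_inv, inv_eq_one, inv_inv] at h
    · refine absurd hpole (LowRank.not_hasPoleAt_of_rep hα0 ?_ hab)
      rw [Polynomial.eval₂_mul]
      exact mul_ne_zero hgα (hb _ hα')
  obtain ⟨hpred, herr⟩ := LowRank.wienerPredictor_spec horth hs₁ hy₁ hpast
  refine ⟨F, W₁.map LowRank.valueAtInfinity, hFproper, hFpole, fun hno i j => ⟨hFproper i j,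
    fun α hα hpole => hno α (hFpole α hα i j hpole).1 (hFpole α hα i j hpole).2⟩, ?_,
    LowRank.isMinimumPhase_const_valueAtInfinity hs₁, herr, hFW ▸ hadv, hFW ▸ hpred,
    fun hFs => ?_, ?_⟩
  · rw [hFW]
    exact LowRank.eq_delay_advance_add_const W₁
  -- Filtering `y₂(t - 1) = W₂ e(t - 1)` by a stable `F` is the same as applying `F W₂ = advance W₁`
  -- to the delayed noise.
  · rw [← LowRank.isOutput_mul_iff hs₂ hFs hbd' (hy₂.shift 1), hFW]
    exact hpred
  · intro F' x v hF' hx hyxv hv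
    have hxp := LowRank.wienerPredictor_unique hx hyxv hv
    have hve : ∀ t i, v t i = ∑ j, W₁.map LowRank.valueAtInfinity i j • e t j := fun t i => by
      have h := herr t i
      rw [← hxp, hyxv, add_sub_cancel_left] at h
      exact h
    have hFF : F' * W₂ = F * W₂ := by
      rw [hFW]
      refine LowRank.IsOutput.transfer_unique (e := fun t => e (t - 1))
        (LowRank.orthonormal_shift horth 1) (hF'.mul hs₂) hadv
        ((LowRank.isOutput_mul_iff hs₂ hF' hbd' (hy₂.shift 1)).2 hx) ?_
      rw [hxp]
      exact hpred
    refine ⟨hxp, hve, hFF, ?_, fun K' hK' hvK' => ?_⟩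
    · rintro rfl
      -- For square matrices the left inverse is two-sided, so `W₂` can be cancelled on the right.
      have hWL : W₂ * L = 1 := mul_eq_one_comm.1 hLW
      rw [← Matrix.mul_one F', ← hWL, ← Matrix.mul_assoc, hFF, Matrix.mul_assoc, hWL,
        Matrix.mul_one]
    · refine LowRank.IsOutput.transfer_unique horth hK' (LowRank.isStable_const _) hvK' ?_
      have h := LowRank.isOutput_const (W₁.map LowRank.valueAtInfinity) e
      convert h using 1
      funext t i
      exact hve t i
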